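/- Let $n\ge 2$, $m\in\mathbb N$, and let $\Omega\subset\mathbb R^n$ be a bounded open set. Let $p:\Omega\to[1,\infty)$ be $\log$-Hölder continuous, i.e. there is $C>0$ with $|p(x)-p(y)|\le C/\log\big(e+\tfrac1{|x-y|}\big)$ for all $x,y\in\Omega$. Put $\varphi(x,t)=\frac1{p(x)}t^{p(x)}$ and $\varphi^*(x,t)=\sup_{s\ge0}\big(st-\varphi(x,s)\big)$. For $\psi\in\{\varphi,\varphi^*\}$ let $\|w\|_\psi=\inf\{\lambda>0 : \int_\Omega\psi(x,|w(x)|/\lambda)\,dx\le1\}$. Here $L^{p(\cdot)}(\Omega;\mathbb R^m)$ is the space of measurable $w:\Omega\to\mathbb R^m$ with $\int_\Omega\varphi(x,\lambda|w(x)|)\,dx<\infty$ for some $\lambda>0$, with norm $\|\cdot\|_\varphi$, and $W^{1,p(\cdot)}(\Omega;\mathbb R^m)$ is the space of $w\in L^{p(\cdot)}(\Omega;\mathbb R^m)$ whose weak gradient satisfies $|\nabla w|\in L^{p(\cdot)}(\Omega)$, with norm $\|w\|_\varphi+\|\nabla w\|_\varphi$ ($|\cdot|$ is the Euclidean norm,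 also for matrices); similarly on $\mathbb R^n$. Assume that $\Omega$ is a $W^{1,p(\cdot)}$-extension domain: there are a $\log$-Hölder continuous $q:\mathbb R^n\to[1,\infty)$ with $q=p$ in $\Omega$ and a bounded linear operator $T:W^{1,p(\cdot)}(\Omega)\to W^{1,q(\cdot)}(\mathbb R^n)$ such that $Tw=w$ a.e. in $\Omega$ for every $w$. Let $f:\mathbb R^{m\times n}\to[0,\infty)$ be continuous with $f(0)=0$, and suppose that there are $c>0$ and $M\ge1$ with $c\,|\xi|\le f(\xi)\le M(1+|\xi|)$ for every $\xi\in\mathbb R^{m\times n}$. For $u\in L^{p(\cdot)}(\Omega;\mathbb R^m)$ let $$\mathcal F(u)=\inf\Big\{\liminf_{h\to\infty}\int_\Omega f(\nabla u_h)^{p(x)}\,dx \;\Big|\; u_h\in W^{1,p(\cdot)}(\Omega;\mathbb R^m),\ u_h\to u\text{ in }L^{p(\cdot)}(\Omega;\mathbb R^m)\Big\}.$$ Let $\mathrm{BV}^{p(\cdot)}(\Omega;\mathbb R^m)$ be the set of $u\in L^{p(\cdot)}(\Omega;\mathbb R^m)$ such that $$\sup\Big\{\sum_{\alpha=1}^m\int_\Omega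 u_\alpha\operatorname{div}w_\alpha\,dx \;\Big|\; w\in[C^1_0(\Omega;\mathbb R^n)]^m,\ \|w\|_{\varphi^*}\le1\Big\}<\infty,$$ where $C^1_0$ denotes $C^1$ functions with compact support in $\Omega$. Then, for every $u\in\mathrm{BV}^{p(\cdot)}(\Omega;\mathbb R^m)$, $$\mathcal F(u)=\inf\Big\{\liminf_{h\to\infty}\int_\Omega f(\nabla u_h)^{p(x)}\,dx \;\Big|\; u_h\in C^\infty(\overline\Omega;\mathbb R^m),\ u_h\to u\text{ in }L^1(\Omega;\mathbb R^m)\Big\},$$ where $C^\infty(\overline\Omega;\mathbb R^m)$ is the set of restrictions to $\overline\Omega$ of functions in $C^\infty(\mathbb R^n;\mathbb R^m)$. -/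

import Mathlib

open MeasureTheory Filter Topology Set
open scoped ENNReal NNReal ContDiff

noncomputable section

namespace VarExp

/-- `ℝᵏ` with the Euclidean norm. -/
abbrev Rn (k : ℕ) : Type := EuclideanSpace ℝ (Fin k)

/-- Real `m × n` matrices with the Euclidean (Frobenius) norm; the entry in row `α` and
column `i` of `ξ` is `ξ (α, i)`. -/
abbrev Mat (m n : ℕ) : Type := EuclideanSpace ℝ (Fin m × Fin n)

variable {n m : ℕ} {E : Type*} [NormedAddCommGroup E]

/-! ### Lebesgue spaces of Orlicz type -/

/-- The modular `∫_Ω φ(x, |w(x)|) dx`. -/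
def modular (Ω : Set (Rn n)) (φ : Rn n → ℝ → ℝ≥0∞) (w : Rn n → ℝ) : ℝ≥0∞ :=
  ∫⁻ x in Ω, φ x |w x|

/-- The Luxemburg norm `inf {t > 0 | ∫_Ω φ(x, |w(x)| / t) dx ≤ 1}`, with value `∞` if there is
no such `t`. -/
def luxNorm (Ω : Set (Rn n)) (φ : Rn n → ℝ → ℝ≥0∞) (w : Rn n → E) : ℝ≥0∞ :=
  sInf {c | ∃ t : ℝ, 0 < t ∧ modular Ω φ (fun x => ‖w x‖ / t) ≤ 1 ∧ c = ENNReal.ofReal t}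

/-- The conjugate function `φ*(x, t) = sup_{s ≥ 0} (s t - φ(x, s))`. (The subtraction is
truncated at `0`, which does not change the supremum as `φ(x, 0) = 0`.) -/
def conj (φ : Rn n → ℝ → ℝ≥0∞) (x : Rn n) (t : ℝ) : ℝ≥0∞ :=
  ⨆ s : {s : ℝ // 0 ≤ s}, (ENNReal.ofReal (s.1 * t) - φ x s.1)

/-- The function `φ(x, t) = t ^ p(x) / p(x)`, for `t ≥ 0`, of the variable exponent `p`. -/
def phi (p : Rn n → ℝ) (x : Rn n) (t : ℝ) : ℝ≥0∞ :=
  ENNReal.ofReal (t ^ p x / p x)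

/-- Membership of a function in the variable exponent Lebesgue space `L^{p(·)}(Ω)`. -/
def MemL (Ω : Set (Rn n)) (p : Rn n → ℝ) (w : Rn n → E) : Prop :=
  AEStronglyMeasurable w (volume.restrict Ω) ∧
    ∃ t : ℝ, 0 < t ∧ modular Ω (phi p) (fun x => t * ‖w x‖) < ⊤

/-- The norm of `L^{p(·)}(Ω)`. -/
def lpNorm (Ω : Set (Rn n)) (p : Rn n → ℝ) (w : Rn n → E) : ℝ≥0∞ :=
  luxNorm Ω (phi p) w

/-- `p` is a variable exponent on `Ω` that is log-Hölder continuous: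
`|p(x) - p(y)| ≤ C / log (e + 1 / |x - y|)` for `x, y ∈ Ω`. (For `x = y` the inequality reads
`0 ≤ C`.) -/
def LogHolder (Ω : Set (Rn n)) (p : Rn n → ℝ) : Prop :=
  ∃ C : ℝ, 0 < C ∧ ∀ x ∈ Ω, ∀ y ∈ Ω,
    |p x - p y| ≤ C / Real.log (Real.exp 1 + 1 / ‖x - y‖)

/-! ### Sobolev spaces -/

/-- `g` is the `i`-th weak partial derivative of the scalar function `u` in the open set `Ω`. -/
def HasWeakPartial (Ω : Set (Rn n)) (u : Rn n → ℝ) (i : Fin n) (g : Rn n → ℝ) : Prop :=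
  LocallyIntegrableOn u Ω ∧ LocallyIntegrableOn g Ω ∧
    ∀ η : Rn n → ℝ, ContDiff ℝ ∞ η → HasCompactSupport η → tsupport η ⊆ Ω →
      ∫ x in Ω, u x * fderiv ℝ η x (EuclideanSpace.single i 1) = - ∫ x in Ω, g x * η x

/-- `u` belongs to `W^{1,p(·)}(Ω)`, with weak gradient `g` (scalar case). -/
def IsSobolev (Ω : Set (Rn n)) (p : Rn n → ℝ) (u : Rn n → ℝ) (g : Rn n → Rn n) : Prop :=
  MemL Ω p u ∧ MemL Ω p g ∧ ∀ i, HasWeakPartial Ω u i (fun x => g x i)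

/-- `u` belongs to `W^{1,p(·)}(Ω; ℝᵐ)`, with weak gradient `G`. -/
def IsSobolevVec (Ω : Set (Rn n)) (p : Rn n → ℝ) (u : Rn n → Rn m) (G : Rn n → Mat m n) : Prop :=
  MemL Ω p u ∧ MemL Ω p G ∧
    ∀ α i, HasWeakPartial Ω (fun x => u x α) i (fun x => G x (α, i))

/-- `Ω` is a `W^{1,p(·)}`-extension domain: for some log-Hölder continuous exponent `q` on `ℝⁿ`
that extends `p`, there is a bounded linear extension operator from `W^{1,p(·)}(Ω)` to
`W^{1,q(·)}(ℝⁿ)`. Elements of the Sobolev spaces are functions modulo equality almost everywhere,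
so linearity and the extension property are understood almost everywhere. -/
def IsExtensionDomain (Ω : Set (Rn n)) (p : Rn n → ℝ) : Prop :=
  ∃ q : Rn n → ℝ, (∀ x, 1 ≤ q x) ∧ LogHolder univ q ∧ EqOn q p Ω ∧
    ∃ (T : (Rn n → ℝ) → (Rn n → ℝ)) (C : ℝ≥0),
      (∀ u v g k, IsSobolev Ω p u g → IsSobolev Ω p v k → T (u + v) =ᵐ[volume] T u + T v) ∧
      (∀ (c : ℝ) u g, IsSobolev Ω p u g → T (c • u) =ᵐ[volume] c • T u) ∧
      (∀ u g, IsSobolev Ω p u g →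
        T u =ᵐ[volume.restrict Ω] u ∧
        ∃ k, IsSobolev univ q (T u) k ∧
          lpNorm univ q (T u) + lpNorm univ q k ≤ C * (lpNorm Ω p u + lpNorm Ω p g))

/-! ### Functions of bounded variation with variable exponent -/

/-- `∑_α u_α div w_α` at the point `x`, with `w_α` the rows of `w`. -/
def pairDiv (u : Rn n → Rn m) (w : Rn n → Mat m n) (x : Rn n) : ℝ :=
  ∑ α, u x α * ∑ i, fderiv ℝ w x (EuclideanSpace.single i 1) (α, i)

/-- The variation `V^m_{p(·)}(u, Ω)`: the supremum of `∫_Ω ∑_α u_α div w_α dx` over the `C¹`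
functions `w`, with compact support in `Ω`, whose norm in `L^{φ*}`, with `φ(x,t) = t^p(x)/p(x)`,
is at most `1`. (`w = 0` is admissible, so the supremum is not negative.) -/
def variation (Ω : Set (Rn n)) (p : Rn n → ℝ) (u : Rn n → Rn m) : ℝ≥0∞ :=
  sSup {c | ∃ w : Rn n → Mat m n, ContDiff ℝ 1 w ∧ HasCompactSupport w ∧ tsupport w ⊆ Ω ∧
    luxNorm Ω (conj (phi p)) w ≤ 1 ∧ c = ENNReal.ofReal (∫ x in Ω, pairDiv u w x)}

/-- Membership in `BV^{p(·)}(Ω; ℝᵐ)`. -/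
def MemBV (Ω : Set (Rn n)) (p : Rn n → ℝ) (u : Rn n → Rn m) : Prop :=
  MemL Ω p u ∧ variation Ω p u < ⊤

/-! ### Energies -/

/-- `∫_Ω f(G(x)) ^ p(x) dx`. -/
def energy (Ω : Set (Rn n)) (p : Rn n → ℝ) (f : Mat m n → ℝ) (G : Rn n → Mat m n) : ℝ≥0∞ :=
  ∫⁻ x in Ω, ENNReal.ofReal (f (G x) ^ p x)

/-- The classical gradient (Jacobian matrix) of a differentiable function. -/
def classicalGrad (v : Rn n → Rn m) (x : Rn n) : Mat m n :=
  WithLp.toLp 2 fun ai : Fin m × Fin n => fderiv ℝ v x (EuclideanSpace.single ai.2 1) ai.1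

/-- The relaxed functional `𝓕(u)`: infimum of `liminf ∫_Ω f(∇u_h)^p(x) dx` over the sequences
`u_h ∈ W^{1,p(·)}(Ω; ℝᵐ)` with `u_h → u` in `L^{p(·)}(Ω; ℝᵐ)`. -/
def relaxed (Ω : Set (Rn n)) (p : Rn n → ℝ) (f : Mat m n → ℝ) (u : Rn n → Rn m) : ℝ≥0∞ :=
  sInf {L | ∃ (v : ℕ → Rn n → Rn m) (G : ℕ → Rn n → Mat m n),
    (∀ h, IsSobolevVec Ω p (v h) (G h)) ∧
    Tendsto (fun h => lpNorm Ω p (v h - u)) atTop (𝓝 0) ∧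
    L = liminf (fun h => energy Ω p f (G h)) atTop}

/-- The infimum of `liminf ∫_Ω f(∇u_h)^p(x) dx` over the sequences `u_h ∈ C^∞(Ω̄; ℝᵐ)`
(restrictions to `Ω̄` of smooth functions on `ℝⁿ`) with `u_h → u` in `L¹(Ω; ℝᵐ)`. -/
def relaxedSmooth (Ω : Set (Rn n)) (p : Rn n → ℝ) (f : Mat m n → ℝ) (u : Rn n → Rn m) : ℝ≥0∞ :=
  sInf {L | ∃ v : ℕ → Rn n → Rn m,
    (∀ h, ContDiff ℝ ∞ (v h)) ∧
    Tendsto (fun h => ∫⁻ x in Ω, ‖v h x - u x‖ₑ) atTop (𝓝 0) ∧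
    L = liminf (fun h => energy Ω p f (classicalGrad (v h))) atTop}

end VarExp

end

/-! For a bounded log-Hölder exponent, mollification works as well as for a constant one. The engine
is `RegularExponent.lintegral_bumpMeasure_rpow_le`: in a ball of radius s the exponent oscillates by
at most C / log(e + 1/s), the averages of a^q with ∫ a^q ≤ K are O(s⁻ⁿ), and s⁻ⁿ raised to the power
C / log(e + 1/s) stays bounded. Hence Jensen's inequality survives, with a constant independent of
s.

`relaxedSmooth_le_relaxed`: a Sobolev function is extended to ℝⁿ and mollified. The estimate
dominates the energies of the mollifications by functions that converge almost everywhere together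
with their integrals, so the energies converge
(`RegularExponent.tendsto_setLIntegral_comp_mollify`).

`relaxed_le_relaxedSmooth`: convergence holds in L¹ only, but the lower bound on f bounds the
gradients in L^{q(·)}. A Poincaré argument at a small scale shows that bounded sets of Sobolev
functions have equi-integrable q(·)-th powers (`RegularExponent.exists_equiintegrable`). This gives
an Ehrling-type inequality (`RegularExponent.exists_lintegral_rpow_le_of_gradient`): a bounded
gradient and a small L¹ norm force a small modular. Applied to differences of the sequence, it
upgrades L¹ convergence to L^{p(·)} convergence. -/

noncomputable section

namespace VarExp

/-! ### Log-Hölder exponents and Jensen's inequality with an oscillating exponent -/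

section

/-! ### Regular exponents -/

/-- A bounded exponent `1 ≤ q ≤ Q` on `ℝⁿ` that is log-Hölder continuous with constant `C`. -/
structure RegularExponent {n : ℕ} (q : Rn n → ℝ) (Q C : ℝ) : Prop where
  one_le : ∀ x, 1 ≤ q x
  le_bound : ∀ x, q x ≤ Q
  cont : Continuous q
  const_nonneg : 0 ≤ C
  -- Any s ≥ ‖x - y‖ is allowed, so that one s, the radius of averaging, serves all points of a
  -- ball, its centre included.
  modulus : ∀ x y s, 0 < s → ‖x - y‖ ≤ s → |q x - q y| ≤ C / Real.log (Real.exp 1 + 1 / s)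

lemma one_le_log_exp_one_add {s : ℝ} (hs : 0 ≤ s) : 1 ≤ Real.log (Real.exp 1 + 1 / s) := by
  have h : 0 ≤ 1 / s := by positivity
  rw [Real.le_log_iff_exp_le (by positivity)]
  linarith

lemma LogHolder.exists_regularExponent {n : ℕ} {q : Rn n → ℝ} (h : LogHolder univ q)
    (h1 : ∀ x, 1 ≤ q x) : ∃ Q C, RegularExponent q Q C := by
  obtain ⟨C, hC, h⟩ := h
  have hmod : ∀ x y s, 0 < s → ‖x - y‖ ≤ s →
      |q x - q y| ≤ C / Real.log (Real.exp 1 + 1 / s) := by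
    intro x y s hs hxy
    -- On the diagonal 1 / ‖x - y‖ is 1 / 0 = 0, so monotonicity in the distance is not available
    -- there.
    rcases eq_or_ne x y with rfl | hne
    · have := one_le_log_exp_one_add hs.le
      simp only [sub_self, abs_zero]
      positivity
    · have hpos : 0 < ‖x - y‖ := norm_pos_iff.2 (sub_ne_zero.2 hne)
      refine (h x trivial y trivial).trans ?_
      have := one_le_log_exp_one_add hs.le
      gcongr
  -- The logarithm is at least 1, so q oscillates by at most C on all of ℝⁿ.
  have hle : ∀ x, q x ≤ q 0 + C := by
    intro x
    have h2 := h x trivial 0 trivial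
    have h3 : C / Real.log (Real.exp 1 + 1 / ‖x - 0‖) ≤ C :=
      div_le_self hC.le (one_le_log_exp_one_add (norm_nonneg _))
    have := le_abs_self (q x - q 0)
    linarith
  refine ⟨q 0 + C, C, h1, hle, ?_, hC.le, hmod⟩
  rw [Metric.continuous_iff]
  intro y ε hε
  -- At this radius the logarithm exceeds C / ε + 1, which brings the modulus of continuity below ε.
  refine ⟨Real.exp (-(C / ε + 1)), Real.exp_pos _, fun x hx => ?_⟩
  rw [Real.dist_eq]
  refine (hmod x y _ (Real.exp_pos _) (by rw [← dist_eq_norm]; exact hx.le)).trans_lt ?_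
  have hlog : C / ε + 1 < Real.log (Real.exp 1 + 1 / Real.exp (-(C / ε + 1))) := by
    rw [Real.lt_log_iff_exp_lt (by positivity), Real.exp_neg, one_div, inv_inv]
    have := Real.exp_pos 1
    linarith
  have hpos : 0 < C / ε := by positivity
  rw [div_lt_iff₀ (by linarith)]
  have : C = ε * (C / ε) := by field_simp
  nlinarith

/-! ### Powers of extended nonnegative reals -/

lemma rpow_le_one_add_rpow {a : ℝ≥0∞} {r s : ℝ} (hr : 0 ≤ r) (h : r ≤ s) :
    a ^ r ≤ 1 + a ^ s := by
  rcases le_total a 1 with ha | ha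
  · exact (ENNReal.rpow_le_one ha hr).trans le_self_add
  · exact (ENNReal.rpow_le_rpow_of_exponent_le ha h).trans le_add_self

lemma le_one_add_rpow {a : ℝ≥0∞} {s : ℝ} (h : 1 ≤ s) : a ≤ 1 + a ^ s := by
  simpa using rpow_le_one_add_rpow (a := a) zero_le_one h

lemma rpow_le_of_le_one {a : ℝ≥0∞} {s : ℝ} (ha : a ≤ 1) (h : 1 ≤ s) : a ^ s ≤ a := by
  simpa using ENNReal.rpow_le_rpow_of_exponent_ge ha h

/-- Jensen's inequality for the power `t ↦ t ^ r`. -/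
lemma lintegral_rpow_le_of_isProbabilityMeasure {Y : Type*} [MeasurableSpace Y] {ν : Measure Y}
    [IsProbabilityMeasure ν] {a : Y → ℝ≥0∞} (ha : AEMeasurable a ν) {r : ℝ} (hr : 1 ≤ r) :
    (∫⁻ y, a y ∂ν) ^ r ≤ ∫⁻ y, a y ^ r ∂ν := by
  have h := eLpNorm'_le_eLpNorm'_of_exponent_le zero_lt_one hr ν ha.aestronglyMeasurable
  simp only [eLpNorm', enorm_eq_self, ENNReal.rpow_one, one_div, inv_one] at h
  exact (ENNReal.le_rpow_inv_iff (by linarith)).1 h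

/-- The effect of a slightly oscillating exponent on Jensen's inequality. -/
lemma lintegral_rpow_le_of_exponent {Y : Type*} [MeasurableSpace Y] {ν : Measure Y}
    [IsProbabilityMeasure ν] {a : Y → ℝ≥0∞} (ha : AEMeasurable a ν) {e : Y → ℝ} {q θ : ℝ}
    {S : ℝ≥0∞} (hq : 1 ≤ q) (hθ : 0 ≤ θ) (he : ∀ᵐ y ∂ν, 1 ≤ e y ∧ q - θ ≤ e y)
    (hS : ∫⁻ y, a y ^ e y ∂ν ≤ S) :
    (∫⁻ y, a y ∂ν) ^ q ≤ (1 + S) ^ θ * (1 + ∫⁻ y, a y ^ e y ∂ν) := by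
  set I := ∫⁻ y, a y ^ e y ∂ν
  -- Almost everywhere r ≤ e(y), so a^r ≤ 1 + a^e(y) pointwise; and q ≤ r (1 + θ), so returning from
  -- the power r to the power q costs only an exponent 1 + θ.
  set r := max 1 (q - θ)
  have hr : 1 ≤ r := le_max_left _ _
  have hrq : q ≤ r * (1 + θ) := by
    have : q - θ ≤ r := le_max_right _ _
    nlinarith
  have h1 : (∫⁻ y, a y ∂ν) ^ r ≤ 1 + I := by
    refine (lintegral_rpow_le_of_isProbabilityMeasure ha hr).trans ?_
    calc ∫⁻ y, a y ^ r ∂ν ≤ ∫⁻ y, (1 + a y ^ e y) ∂ν := by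
          refine lintegral_mono_ae ?_
          filter_upwards [he] with y hy
          exact rpow_le_one_add_rpow (by linarith) (max_le hy.1 hy.2)
      _ = 1 + I := by
          rw [lintegral_add_left measurable_const]
          simp [I]
  have hone : 1 ≤ 1 + I := le_self_add
  calc (∫⁻ y, a y ∂ν) ^ q = ((∫⁻ y, a y ∂ν) ^ r) ^ (q / r) := by
        rw [← ENNReal.rpow_mul]
        congr 1
        field_simp
    _ ≤ (1 + I) ^ (q / r) := ENNReal.rpow_le_rpow h1 (by positivity)
    _ ≤ (1 + I) ^ (1 + θ) := by
        refine ENNReal.rpow_le_rpow_of_exponent_le hone ?_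
        rw [div_le_iff₀ (by linarith)]
        linarith
    _ = (1 + I) ^ θ * (1 + I) := by
        rw [ENNReal.rpow_add_of_nonneg _ _ zero_le_one hθ, ENNReal.rpow_one, mul_comm]
    -- Only the small power is estimated by S; the factor 1 + I is kept, to be integrated later.
    _ ≤ (1 + S) ^ θ * (1 + I) := by gcongr

/-- The log-Hölder condition makes powers of `s⁻ⁿ` with small exponents bounded. -/
lemma one_add_inv_pow_rpow_le (n : ℕ) {B C s : ℝ} (hB : 0 ≤ B) (hC : 0 ≤ C) (hs : 0 < s) :
    (1 + ENNReal.ofReal (B * (s ^ n)⁻¹)) ^ (C / Real.log (Real.exp 1 + 1 / s)) ≤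
      ENNReal.ofReal ((1 + B) ^ C * Real.exp (n * C)) := by
  have hl := one_le_log_exp_one_add hs.le
  set L := Real.log (Real.exp 1 + 1 / s)
  set θ := C / L
  have hθ : 0 ≤ θ := by positivity
  have hθC : θ ≤ C := div_le_self hC hl
  rw [← ENNReal.ofReal_one, ← ENNReal.ofReal_add zero_le_one (by positivity),
    ENNReal.ofReal_rpow_of_nonneg (by positivity) hθ]
  refine ENNReal.ofReal_le_ofReal ?_
  -- Since s⁻ⁿ ≤ exp(nL) and θL = C, the power θ of s⁻ⁿ is at most exp(nC).
  have hexp : Real.exp L = Real.exp 1 + 1 / s := Real.exp_log (by positivity)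
  have hE : 1 ≤ Real.exp L ^ n := one_le_pow₀ (Real.one_le_exp (by linarith))
  have hsn : (s ^ n)⁻¹ ≤ Real.exp L ^ n := by
    rw [← inv_pow, hexp, one_div]
    gcongr
    have := Real.exp_pos 1
    linarith
  have hbase : 1 + B * (s ^ n)⁻¹ ≤ (1 + B) * Real.exp L ^ n := by nlinarith
  calc (1 + B * (s ^ n)⁻¹) ^ θ ≤ ((1 + B) * Real.exp L ^ n) ^ θ := by gcongr
    _ = (1 + B) ^ θ * Real.exp (n * C) := by
        rw [Real.mul_rpow (by positivity) (by positivity), ← Real.exp_nat_mul, ← Real.exp_mul]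
        congr 2
        simp only [θ]
        field_simp
    _ ≤ (1 + B) ^ C * Real.exp (n * C) := by
        gcongr
        linarith

end

/-! ### Averages over small balls in variable exponent spaces -/

section

/-! ### Mollification -/

/-- The bump functions at the origin, with support in the ball of radius `1 / (j + 1)`. -/
def bump (n j : ℕ) : ContDiffBump (0 : Rn n) where
  rIn := 1 / ((j : ℝ) + 1) / 2
  rOut := 1 / ((j : ℝ) + 1)
  rIn_pos := by positivity
  rIn_lt_rOut := half_lt_self (by positivity)

/-- The probability measure whose density is a normalized bump function. -/
def bumpMeasure (n j : ℕ) : Measure (Rn n) :=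
  volume.withDensity fun y => ENNReal.ofReal ((bump n j).normed volume y)

/-- The mollifications of a function. -/
def mollify {n : ℕ} {E : Type*} [NormedAddCommGroup E] [NormedSpace ℝ E] (j : ℕ) (g : Rn n → E) :
    Rn n → E :=
  convolution ((bump n j).normed volume) g (ContinuousLinearMap.lsmul ℝ ℝ) volume

variable {n : ℕ}

instance (j : ℕ) : IsProbabilityMeasure (bumpMeasure n j) := by
  constructor
  rw [bumpMeasure, withDensity_apply _ MeasurableSet.univ, Measure.restrict_univ,
    ← ofReal_integral_eq_lintegral_ofReal (bump n j).integrable_normed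
      (Eventually.of_forall (bump n j).nonneg_normed), (bump n j).integral_normed,
    ENNReal.ofReal_one]

lemma ae_bumpMeasure_norm_le (j : ℕ) : ∀ᵐ y ∂bumpMeasure n j, ‖y‖ ≤ 1 / ((j : ℝ) + 1) := by
  rw [bumpMeasure, ae_withDensity_iff
    ((bump n j).continuous_normed.measurable.ennreal_ofReal)]
  refine Eventually.of_forall fun y hy => ?_
  have : y ∈ Function.support ((bump n j).normed volume) := by
    intro h
    simp [h] at hy
  rw [(bump n j).support_normed_eq] at this
  exact (mem_ball_zero_iff.1 this).le

/-- The inverse of the volume of the ball of radius `1 / 2`. -/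
def ballConst (n : ℕ) : ℝ := 2 ^ n / volume.real (Metric.ball (0 : Rn n) 1)

lemma ballConst_nonneg (n : ℕ) : 0 ≤ ballConst n := by unfold ballConst; positivity

/-- A normalized bump is at most the inverse volume of its inner ball, whose radius is half of 1 /
(j + 1); hence the factor 2ⁿ in `ballConst`. -/
lemma bumpMeasure_le (j : ℕ) : bumpMeasure n j ≤
    ENNReal.ofReal (ballConst n * ((1 / ((j : ℝ) + 1)) ^ n)⁻¹) • volume := by
  rw [← withDensity_const]
  refine withDensity_mono (Eventually.of_forall fun y => ENNReal.ofReal_le_ofReal ?_)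
  refine ((bump n j).normed_le_div_measure_closedBall_rIn volume y).trans_eq ?_
  rw [Measure.addHaar_real_closedBall _ _ (bump n j).rIn_pos.le]
  simp only [bump, finrank_euclideanSpace, Fintype.card_fin, ballConst]
  rw [div_pow _ 2, div_mul_eq_mul_div, one_div_div, div_eq_mul_inv, div_eq_mul_inv, mul_inv]
  ring

/-- Dilation by t contributes t⁻ⁿ and the reflected translation preserves volume, so only the
effective radius t / (j + 1) matters. The parameter t serves averages along segments. -/
lemma map_bumpMeasure_le (j : ℕ) {t : ℝ} (ht : 0 < t) (x : Rn n) :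
    (bumpMeasure n j).map (fun y => x - t • y) ≤
      ENNReal.ofReal (ballConst n * ((t * (1 / ((j : ℝ) + 1))) ^ n)⁻¹) • volume := by
  have hm : Measurable fun y : Rn n => x - t • y := by fun_prop
  refine (Measure.map_mono (bumpMeasure_le j) hm).trans_eq ?_
  have h2 : (volume : Measure (Rn n)).map (fun y => x - t • y) =
      ENNReal.ofReal (t ^ n)⁻¹ • volume := by
    rw [show (fun y : Rn n => x - t • y) = (fun z => x - z) ∘ (fun y => t • y) from rfl,
      ← Measure.map_map (by fun_prop) (by fun_prop), Measure.map_addHaar_smul _ ht.ne',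
      Measure.map_smul, (Measure.measurePreserving_sub_left volume x).map_eq]
    simp only [finrank_euclideanSpace, Fintype.card_fin]
    rw [abs_of_nonneg (by positivity)]
  rw [Measure.map_smul, h2, smul_smul, ← ENNReal.ofReal_mul
    (mul_nonneg (ballConst_nonneg n) (by positivity)), mul_pow, mul_inv]
  ring_nf

lemma lintegral_bumpMeasure_le (j : ℕ) {t : ℝ} (ht : 0 < t) (x : Rn n) {a : Rn n → ℝ≥0∞}
    (ha : Measurable a) : ∫⁻ y, a (x - t • y) ∂bumpMeasure n j ≤
      ENNReal.ofReal (ballConst n * ((t * (1 / ((j : ℝ) + 1))) ^ n)⁻¹) * ∫⁻ y, a y := by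
  rw [← lintegral_map ha (by fun_prop)]
  refine (lintegral_mono' (map_bumpMeasure_le j ht x) le_rfl).trans_eq ?_
  rw [lintegral_smul_measure, smul_eq_mul]

lemma integrable_bumpMeasure {F : Type*} [NormedAddCommGroup F] (j : ℕ) (x : Rn n) {g : Rn n → F} (hg : Integrable g) :
    Integrable (fun y => g (x - y)) (bumpMeasure n j) := by
  have h := map_bumpMeasure_le j zero_lt_one x
  simp only [one_smul] at h
  exact ((hg.smul_measure ENNReal.ofReal_ne_top).mono_measure h).comp_measurable (by fun_prop)

/-- Tonelli and translation invariance: averaging against a probability measure preserves total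
mass. -/
lemma lintegral_lintegral_bumpMeasure (j : ℕ) (t : ℝ) {b : Rn n → ℝ≥0∞} (hb : Measurable b) :
    ∫⁻ x, ∫⁻ y, b (x - t • y) ∂bumpMeasure n j = ∫⁻ x, b x := by
  rw [lintegral_lintegral_swap (by fun_prop)]
  simp only [lintegral_sub_right_eq_self b, lintegral_const, measure_univ, mul_one]

/-- The pointwise estimate for averages of functions in `L^{q(·)}`, uniform in the radius. -/
lemma RegularExponent.lintegral_bumpMeasure_rpow_le {q : Rn n → ℝ} {Q C : ℝ}
    (hq : RegularExponent q Q C) (K : ℝ≥0) :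
    ∃ D : ℝ≥0, ∀ (j : ℕ) (t : ℝ), 0 < t → t ≤ 1 → ∀ (x : Rn n) (a : Rn n → ℝ≥0∞), Measurable a →
      ∫⁻ y, a y ^ q y ≤ K →
      (∫⁻ y, a (x - t • y) ∂bumpMeasure n j) ^ q x ≤
        D * (1 + ∫⁻ y, a (x - t • y) ^ q (x - t • y) ∂bumpMeasure n j) := by
  refine ⟨Real.toNNReal ((1 + ballConst n * K) ^ C * Real.exp (n * C)), ?_⟩
  intro j t ht ht1 x a ha haK
  have hqm := hq.cont.measurable
  set s : ℝ := t * (1 / ((j : ℝ) + 1))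
  have hs : 0 < s := by positivity
  -- The averaged modular may blow up like s⁻ⁿ; the exponent C / log(e + 1/s) used below absorbs
  -- this.
  have hS : ∫⁻ y, a (x - t • y) ^ q (x - t • y) ∂bumpMeasure n j ≤
      ENNReal.ofReal (ballConst n * K * (s ^ n)⁻¹) := by
    refine (lintegral_bumpMeasure_le j ht x (a := fun y => a y ^ q y) (by fun_prop)).trans ?_
    refine (mul_le_mul_right haK _).trans_eq ?_
    rw [← ENNReal.ofReal_coe_nnreal, ← ENNReal.ofReal_mul
      (mul_nonneg (ballConst_nonneg n) (by positivity))]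
    congr 1
    ring
  have hlog := one_le_log_exp_one_add hs.le
  have hC := hq.const_nonneg
  refine (lintegral_rpow_le_of_exponent (by fun_prop) (hq.one_le x)
    (θ := C / Real.log (Real.exp 1 + 1 / s)) (by positivity) ?_ hS).trans ?_
  · filter_upwards [ae_bumpMeasure_norm_le (n := n) j] with y hy
    refine ⟨hq.one_le _, ?_⟩
    have := hq.modulus x (x - t • y) s hs (by
      rw [sub_sub_cancel, norm_smul, Real.norm_of_nonneg ht.le]
      exact mul_le_mul_of_nonneg_left hy ht.le)
    have := (abs_le.1 this).2
    linarith
  · gcongr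
    exact one_add_inv_pow_rpow_le n (mul_nonneg (ballConst_nonneg n) K.2) hC hs

/-! ### Mollifications of functions -/

variable {E : Type*} [NormedAddCommGroup E] [NormedSpace ℝ E]

lemma mollify_eq_integral (j : ℕ) (g : Rn n → E) (x : Rn n) :
    mollify j g x = ∫ y, g (x - y) ∂bumpMeasure n j := by
  rw [bumpMeasure, integral_withDensity_eq_integral_toReal_smul
    ((bump n j).continuous_normed.measurable.ennreal_ofReal)
    (Eventually.of_forall fun _ => ENNReal.ofReal_lt_top)]
  simp only [mollify, convolution_def, ContinuousLinearMap.lsmul_apply]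
  exact integral_congr_ae (Eventually.of_forall fun y => by
    simp only [ENNReal.toReal_ofReal ((bump n j).nonneg_normed y)])

lemma enorm_mollify_le (j : ℕ) (g : Rn n → E) (x : Rn n) :
    ‖mollify j g x‖ₑ ≤ ∫⁻ y, ‖g (x - y)‖ₑ ∂bumpMeasure n j := by
  rw [mollify_eq_integral]
  exact enorm_integral_le_lintegral_enorm _

lemma contDiff_mollify [CompleteSpace E] (j : ℕ) {g : Rn n → E} (hg : LocallyIntegrable g) :
    ContDiff ℝ ∞ (mollify j g) :=
  (bump n j).hasCompactSupport_normed.contDiff_convolution_left _ (bump n j).contDiff_normed hg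

lemma ae_tendsto_mollify [CompleteSpace E] {g : Rn n → E} (hg : LocallyIntegrable g) :
    ∀ᵐ x, Tendsto (fun j => mollify j g x) atTop (𝓝 (g x)) := by
  -- `K = 2` is the ratio of the outer to the inner radius of the bumps.
  refine ContDiffBump.ae_convolution_tendsto_right_of_locallyIntegrable (φ := bump n) (K := 2)
    tendsto_one_div_add_atTop_nhds_zero_nat (Eventually.of_forall fun j => ?_) hg
  simp only [bump]
  linarith

lemma ae_tendsto_lintegral_bumpMeasure {F : Rn n → ℝ} (hF : Integrable F) (h0 : ∀ x, 0 ≤ F x) :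
    ∀ᵐ x, Tendsto (fun j => ∫⁻ y, ENNReal.ofReal (F (x - y)) ∂bumpMeasure n j) atTop
      (𝓝 (ENNReal.ofReal (F x))) := by
  filter_upwards [ae_tendsto_mollify hF.locallyIntegrable] with x hx
  refine (ENNReal.tendsto_ofReal hx).congr fun j => ?_
  rw [mollify_eq_integral, ofReal_integral_eq_lintegral_ofReal (integrable_bumpMeasure j x hF)
    (Eventually.of_forall fun y => h0 _)]

lemma mollify_apply {ι : Type*} [Fintype ι] (j : ℕ) {g : Rn n → EuclideanSpace ℝ ι}
    (hg : LocallyIntegrable g) (x : Rn n) (i : ι) :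
    mollify j g x i = mollify j (fun y => g y i) x := by
  have h := (((bump n j).hasCompactSupport_normed (μ := volume)).convolutionExists_left
    (ContinuousLinearMap.lsmul ℝ ℝ) (bump n j).continuous_normed hg) x
  have := (EuclideanSpace.proj (𝕜 := ℝ) i : EuclideanSpace ℝ ι →L[ℝ] ℝ).integral_comp_comm h
  simp only [mollify, convolution_def]
  exact this.symm

/-- The derivative falls on the bump φ, and y ↦ φ(x - y) is an admissible test function; the sign
from the reflection cancels the one in the definition of the weak derivative. -/
lemma fderiv_mollify_of_hasWeakPartial (j : ℕ) {w k : Rn n → ℝ} {i : Fin n}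
    (h : HasWeakPartial univ w i k) (x : Rn n) :
    fderiv ℝ (mollify j w) x (EuclideanSpace.single i 1) = mollify j k x := by
  obtain ⟨hw, -, h⟩ := h
  set φ := (bump n j).normed volume
  have hφ : ContDiff ℝ ∞ φ := (bump n j).contDiff_normed
  have hφ1 : ContDiff ℝ 1 φ := hφ.of_le (by exact_mod_cast le_top)
  have hφc : HasCompactSupport φ := (bump n j).hasCompactSupport_normed
  have hw' : LocallyIntegrable w := locallyIntegrableOn_univ.1 hw
  have hd := hφc.hasFDerivAt_convolution_right (ContinuousLinearMap.lsmul ℝ ℝ).flip hw' hφ1 x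
  rw [convolution_flip] at hd
  change HasFDerivAt (mollify j w) _ x at hd
  rw [hd.fderiv, convolution_precompR_apply _ hw' (hφc.fderiv ℝ)
    (hφ1.continuous_fderiv one_ne_zero)]
  have hη : ContDiff ℝ ∞ fun y => φ (x - y) := hφ.comp (contDiff_const.sub contDiff_id)
  have hηc : HasCompactSupport fun y => φ (x - y) :=
    hφc.comp_homeomorph (Homeomorph.subLeft x)
  have hdη : ∀ y, fderiv ℝ (fun y => φ (x - y)) y (EuclideanSpace.single i 1) =
      - fderiv ℝ φ (x - y) (EuclideanSpace.single i 1) := by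
    intro y
    have h1 := ((hφ1.differentiable one_ne_zero) (x - y)).hasFDerivAt.comp y
      ((hasFDerivAt_id y).const_sub x)
    have h2 : fderiv ℝ (fun y => φ (x - y)) y = _ := h1.fderiv
    rw [h2]
    simp
  have hmain := h _ hη hηc (subset_univ _)
  simp only [hdη, Measure.restrict_univ, mul_neg, integral_neg, neg_inj] at hmain
  rw [convolution_def, mollify, convolution_eq_swap]
  simpa [mul_comm] using hmain

end

section

/-! ### Convergence of integrals of mollifications -/

/-- A version of the dominated convergence theorem with converging dominating functions. -/
lemma tendsto_lintegral_of_tendsto_bound {X : Type*} [MeasurableSpace X] {ν : Measure X}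
    {h b : ℕ → X → ℝ≥0∞} {h' b' : X → ℝ≥0∞} (hm : ∀ j, AEMeasurable (h j) ν)
    (bm : ∀ j, AEMeasurable (b j) ν) (bm' : AEMeasurable b' ν) (hb : ∀ j, ∀ᵐ x ∂ν, h j x ≤ b j x)
    (hlim : ∀ᵐ x ∂ν, Tendsto (fun j => h j x) atTop (𝓝 (h' x)))
    (blim : ∀ᵐ x ∂ν, Tendsto (fun j => b j x) atTop (𝓝 (b' x)))
    (hfin : ∫⁻ x, b' x ∂ν ≠ ⊤)
    (hint : Tendsto (fun j => ∫⁻ x, b j x ∂ν) atTop (𝓝 (∫⁻ x, b' x ∂ν))) :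
    Tendsto (fun j => ∫⁻ x, h j x ∂ν) atTop (𝓝 (∫⁻ x, h' x ∂ν)) := by
  have hfin' : ∀ᵐ x ∂ν, b' x < ⊤ := ae_lt_top' bm' hfin
  -- Each h j is at most min (h j) b' plus the excess (b j - b')₊. The first term is dominated by
  -- the fixed b'; the second is shown to vanish in L¹.
  have hmin : Tendsto (fun j => ∫⁻ x, min (h j x) (b' x) ∂ν) atTop (𝓝 (∫⁻ x, h' x ∂ν)) := by
    refine tendsto_lintegral_of_dominated_convergence' b' (fun j => (hm j).min bm')
      (fun j => Eventually.of_forall fun x => min_le_right _ _) hfin ?_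
    filter_upwards [hlim, blim, ae_all_iff.2 hb] with x h1 h2 h3
    have h4 : h' x ≤ b' x := le_of_tendsto_of_tendsto' h1 h2 h3
    have := h1.min (tendsto_const_nhds (x := b' x))
    rwa [min_eq_left h4] at this
  have hneg : Tendsto (fun j => ∫⁻ x, (b' x - b j x) ∂ν) atTop (𝓝 0) := by
    have := tendsto_lintegral_of_dominated_convergence' (μ := ν) (F := fun j x => b' x - b j x)
      (f := fun _ => 0) b' (fun j => bm'.sub (bm j))
      (fun j => Eventually.of_forall fun x => tsub_le_self) hfin ?_
    · simpa using this
    · filter_upwards [blim, hfin'] with x h1 h2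
      have := ENNReal.Tendsto.sub (tendsto_const_nhds (x := b' x)) h1 (Or.inl h2.ne)
      rwa [tsub_self] at this
  -- From b + (b' - b)₊ = max(b, b') = b' + (b - b')₊, convergence of the integrals transfers
  -- smallness from one part of the difference to the other, as in Scheffé's lemma.
  have hpos : Tendsto (fun j => ∫⁻ x, (b j x - b' x) ∂ν) atTop (𝓝 0) := by
    have h1 : Tendsto (fun j => (∫⁻ x, b j x ∂ν + ∫⁻ x, (b' x - b j x) ∂ν) - ∫⁻ x, b' x ∂ν) atTop
        (𝓝 ((∫⁻ x, b' x ∂ν + 0) - ∫⁻ x, b' x ∂ν)) :=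
      ENNReal.Tendsto.sub (hint.add hneg) tendsto_const_nhds (Or.inr hfin)
    rw [add_zero, tsub_self] at h1
    refine h1.congr fun j => ?_
    rw [← lintegral_add_left' (bm j)]
    have : ∫⁻ x, (b j x + (b' x - b j x)) ∂ν = ∫⁻ x, b' x ∂ν + ∫⁻ x, (b j x - b' x) ∂ν := by
      rw [← lintegral_add_left' bm']
      exact lintegral_congr fun x => by rw [add_tsub_eq_max, add_tsub_eq_max, max_comm]
    rw [this, ENNReal.add_sub_cancel_left hfin]
  refine tendsto_of_tendsto_of_tendsto_of_le_of_le hmin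
    (by simpa using hmin.add hpos) (fun j => lintegral_mono fun x => min_le_left _ _)
    (fun j => ?_)
  rw [← lintegral_add_left' ((hm j).min bm')]
  refine lintegral_mono_ae ?_
  filter_upwards [hb j] with x hx
  rcases le_total (h j x) (b' x) with hle | hle
  · rw [min_eq_left hle]
    exact le_self_add
  · rw [min_eq_right hle, add_tsub_cancel_of_le (hle.trans hx)]
    exact hx

variable {n : ℕ} {q : Rn n → ℝ} {Q C : ℝ}

lemma RegularExponent.pos (hq : RegularExponent q Q C) (x : Rn n) : 0 < q x :=
  zero_lt_one.trans_le (hq.one_le x)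

lemma RegularExponent.ofReal_norm_rpow {E : Type*} [NormedAddCommGroup E]
    (hq : RegularExponent q Q C) (x : Rn n) (ξ : E) :
    ENNReal.ofReal (‖ξ‖ ^ q x) = ‖ξ‖ₑ ^ q x := by
  rw [← ENNReal.ofReal_rpow_of_nonneg (norm_nonneg _) (hq.pos x).le, ofReal_norm]

/-- With F = |g|^q, the Jensen-type estimate dominates the integrand by b₀ plus a multiple of the
average of F. These bounds converge almost everywhere and their integrals do not depend on j. The
growth bound admits |g|^q so that H may be the distance to g as well as an energy density. -/
lemma RegularExponent.tendsto_setLIntegral_comp_mollify {ι : Type*} [Fintype ι]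
    (hq : RegularExponent q Q C) {Ω : Set (Rn n)} (hΩ : MeasurableSet Ω) (hΩfin : volume Ω ≠ ⊤)
    {g : Rn n → EuclideanSpace ℝ ι} (hg : Measurable g) (hgl : LocallyIntegrable g)
    (hgq : ∫⁻ x, ‖g x‖ₑ ^ q x ≠ ⊤) {H : Rn n → EuclideanSpace ℝ ι → ℝ≥0∞}
    (hHc : ∀ x ∈ Ω, Continuous (H x))
    (hHm : ∀ j, AEMeasurable (fun x => H x (mollify j g x)) (volume.restrict Ω)) (c : ℝ≥0)
    (hH : ∀ x ∈ Ω, ∀ ξ, H x ξ ≤ c * (1 + ‖ξ‖ₑ ^ q x + ‖g x‖ₑ ^ q x)) :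
    Tendsto (fun j => ∫⁻ x in Ω, H x (mollify j g x)) atTop (𝓝 (∫⁻ x in Ω, H x (g x))) := by
  have hqm := hq.cont.measurable
  obtain ⟨D, hD⟩ := hq.lintegral_bumpMeasure_rpow_le (∫⁻ x, ‖g x‖ₑ ^ q x).toNNReal
  rw [ENNReal.coe_toNNReal hgq] at hD
  set F : Rn n → ℝ≥0∞ := fun x => ‖g x‖ₑ ^ q x with hFdef
  have hFm : Measurable F := by fun_prop
  have hF : F = fun x => ENNReal.ofReal (‖g x‖ ^ q x) :=
    funext fun x => (hq.ofReal_norm_rpow x (g x)).symm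
  have hFint : Integrable fun x => ‖g x‖ ^ q x := by
    refine ⟨(by fun_prop : Measurable fun x => ‖g x‖ ^ q x).aestronglyMeasurable, ?_⟩
    rw [hasFiniteIntegral_iff_ofReal (Eventually.of_forall fun x => by positivity)]
    rw [← hF]
    exact hgq.lt_top
  have hFlim := ae_tendsto_lintegral_bumpMeasure hFint (fun x => by positivity)
  have hmF : ∀ j, Measurable fun x => ∫⁻ y, F (x - y) ∂bumpMeasure n j := fun j =>
    Measurable.lintegral_prod_right' (f := fun z : Rn n × Rn n => F (z.1 - z.2)) (by fun_prop)
  set b₀ : Rn n → ℝ≥0∞ := Ω.indicator fun x => c * (1 + D + F x) with hb₀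
  have hb₀m : Measurable b₀ := Measurable.indicator (by fun_prop) hΩ
  have hmain := tendsto_lintegral_of_tendsto_bound (ν := volume)
    (h := fun j => Ω.indicator fun x => H x (mollify j g x))
    (h' := Ω.indicator fun x => H x (g x))
    (b := fun j x => b₀ x + c * D * ∫⁻ y, F (x - y) ∂bumpMeasure n j)
    (b' := fun x => b₀ x + c * D * F x)
    (fun j => (aemeasurable_indicator_iff hΩ).2 (hHm j))
    (fun j => (hb₀m.add ((hmF j).const_mul _)).aemeasurable)
    (hb₀m.add (hFm.const_mul _)).aemeasurable ?_ ?_ ?_ ?_ ?_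
  · simpa only [lintegral_indicator hΩ] using hmain
  · refine fun j => Eventually.of_forall fun x => ?_
    by_cases hx : x ∈ Ω
    · simp only [hb₀, indicator_of_mem hx]
      have h1 := hD j 1 zero_lt_one le_rfl x (fun y => ‖g y‖ₑ) hg.enorm le_rfl
      simp only [one_smul] at h1
      have h2 : ‖mollify j g x‖ₑ ^ q x ≤ D * (1 + ∫⁻ y, F (x - y) ∂bumpMeasure n j) :=
        (ENNReal.rpow_le_rpow (enorm_mollify_le j g x) (hq.pos x).le).trans h1
      calc H x (mollify j g x) ≤ c * (1 + ‖mollify j g x‖ₑ ^ q x + F x) := hH x hx _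
        _ ≤ c * (1 + D * (1 + ∫⁻ y, F (x - y) ∂bumpMeasure n j) + F x) := by gcongr
        _ = _ := by ring
    · simp [indicator_of_notMem hx]
  · filter_upwards [ae_tendsto_mollify hgl] with x hx
    by_cases hxΩ : x ∈ Ω
    · simp only [indicator_of_mem hxΩ]
      exact ((hHc x hxΩ).tendsto _).comp hx
    · simp only [indicator_of_notMem hxΩ]
      exact tendsto_const_nhds
  · filter_upwards [hFlim] with x hx
    rw [hF]
    exact tendsto_const_nhds.add (ENNReal.Tendsto.const_mul hx (Or.inr (by finiteness)))
  · rw [lintegral_add_left hb₀m, lintegral_const_mul _ hFm, hb₀, lintegral_indicator hΩ,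
      lintegral_const_mul _ (by fun_prop), lintegral_add_left (by fun_prop), setLIntegral_const]
    have : ∫⁻ x in Ω, F x ≠ ⊤ := ne_top_of_le_ne_top hgq (setLIntegral_le_lintegral _ _)
    finiteness
  · have h1 : ∀ j, ∫⁻ x, (b₀ x + c * D * ∫⁻ y, F (x - y) ∂bumpMeasure n j) =
        ∫⁻ x, (b₀ x + c * D * F x) := by
      intro j
      rw [lintegral_add_left hb₀m, lintegral_add_left hb₀m, lintegral_const_mul _ (hmF j),
        lintegral_const_mul _ hFm]
      have := lintegral_lintegral_bumpMeasure j 1 hFm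
      simp only [one_smul] at this
      rw [this]
    simp only [h1]
    exact tendsto_const_nhds

end

section

/-! ### Equi-integrability of bounded sets of Sobolev functions -/

variable {n : ℕ} {q : Rn n → ℝ} {Q C : ℝ}

lemma exists_pos_mul_le {c ε : ℝ≥0∞} (hc : c ≠ ⊤) (hε : ε ≠ 0) : ∃ κ, 0 < κ ∧ c * κ ≤ ε := by
  refine ⟨ε / (c + 1), ENNReal.div_pos hε (by finiteness), ?_⟩
  exact (mul_le_mul_left le_self_add _).trans ENNReal.mul_div_le

/-- The fundamental theorem of calculus along a segment. -/
lemma enorm_sub_le_lintegral_fderiv {F : Type*} [NormedAddCommGroup F] [NormedSpace ℝ F]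
    {W : F → ℝ} (hW : ContDiff ℝ 1 W) (x y : F) :
    ‖W x - W (x - y)‖ₑ ≤ ‖y‖ₑ * ∫⁻ t in Ioc (0 : ℝ) 1, ‖fderiv ℝ W (x - t • y)‖ₑ := by
  have hline : ∀ t : ℝ, HasDerivAt (fun t : ℝ => x - t • y) (-y) t := fun t => by
    simpa using ((hasDerivAt_id t).smul_const y).const_sub x
  have hd : ∀ t : ℝ, HasDerivAt (fun t : ℝ => W (x - t • y)) (fderiv ℝ W (x - t • y) (-y)) t :=
    fun t => ((hW.differentiable one_ne_zero) _).hasFDerivAt.comp_hasDerivAt t (hline t)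
  have hcont' : Continuous fun t : ℝ => fderiv ℝ W (x - t • y) :=
    (hW.continuous_fderiv one_ne_zero).comp (by fun_prop)
  have hcont : Continuous fun t : ℝ => fderiv ℝ W (x - t • y) (-y) :=
    hcont'.clm_apply continuous_const
  have h := intervalIntegral.integral_eq_sub_of_hasDerivAt (fun t _ => hd t)
    (hcont.intervalIntegrable 0 1)
  simp only [one_smul, zero_smul, sub_zero] at h
  rw [← enorm_neg, neg_sub, ← h, intervalIntegral.integral_of_le zero_le_one,
    ← lintegral_const_mul _ hcont'.enorm.measurable]
  refine (enorm_integral_le_lintegral_enorm _).trans (lintegral_mono fun t => ?_)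
  rw [mul_comm]
  simpa using (fderiv ℝ W (x - t • y)).le_opENorm (-y)

lemma RegularExponent.locallyIntegrable {E : Type*} [NormedAddCommGroup E] [MeasurableSpace E]
    [BorelSpace E] [SecondCountableTopology E] (hq : RegularExponent q Q C) {g : Rn n → E}
    (hg : Measurable g) (h : ∫⁻ x, ‖g x‖ₑ ^ q x ≠ ⊤) : LocallyIntegrable g := by
  rw [locallyIntegrable_iff]
  refine fun S hS => ⟨hg.aestronglyMeasurable, ?_⟩
  calc ∫⁻ x in S, ‖g x‖ₑ ≤ ∫⁻ x in S, (1 + ‖g x‖ₑ ^ q x) :=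
        lintegral_mono fun x => le_one_add_rpow (hq.one_le x)
    _ = volume S + ∫⁻ x in S, ‖g x‖ₑ ^ q x := by
        rw [lintegral_add_left measurable_const, setLIntegral_const, one_mul]
    _ < ⊤ := ENNReal.add_lt_top.2
        ⟨hS.measure_lt_top, (setLIntegral_le_lintegral _ _).trans_lt h.lt_top⟩

/-- At scale δ, |W(x)| is at most an average of |W| plus δ times an average of |∇W| along segments.
The q-th power of the first average has a bound depending on δ but not on W, hence a small integral
over small sets; the second contributes O(δ) uniformly. So δ is fixed first, then κ. -/
lemma RegularExponent.exists_equiintegrable_contDiff (hq : RegularExponent q Q C)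
    {Ω B : Set (Rn n)} (hΩfin : volume Ω ≠ ⊤) (hB : MeasurableSet B)
    (hΩB : ∀ x ∈ Ω, ∀ y, ‖y‖ ≤ 1 → x - y ∈ B) (K : ℝ≥0) {ε : ℝ≥0∞} (hε : ε ≠ 0) :
    ∃ κ : ℝ≥0∞, 0 < κ ∧ ∀ W : Rn n → ℝ, ContDiff ℝ 1 W → ∫⁻ x in B, ‖W x‖ₑ ^ q x ≤ K →
      ∫⁻ x in B, ‖fderiv ℝ W x‖ₑ ^ q x ≤ K → ∀ A ⊆ Ω, MeasurableSet A → volume A ≤ κ →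
      ∫⁻ x in A, ‖W x‖ₑ ^ q x ≤ ε := by
  have hqm := hq.cont.measurable
  obtain ⟨D, hD⟩ := hq.lintegral_bumpMeasure_rpow_le K
  have hε2 : ε / 2 ≠ 0 := by simpa using hε
  set δ : ℕ → ℝ := fun j => 1 / ((j : ℝ) + 1) with hδ
  have hδ1 : ∀ j, δ j ≤ 1 := fun j => by
    rw [hδ]
    exact (div_le_one (by positivity)).2 (by linarith [j.cast_nonneg (α := ℝ)])
  obtain ⟨j, hj⟩ : ∃ j : ℕ, ENNReal.ofReal (δ j) * (2 ^ Q * (D * (volume Ω + K))) ≤ ε / 2 := by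
    have h1 : Tendsto (fun j => ENNReal.ofReal (δ j) * ((2 : ℝ≥0∞) ^ Q * (D * (volume Ω + K)))) atTop
        (𝓝 (ENNReal.ofReal 0 * (2 ^ Q * (D * (volume Ω + K))))) :=
      ENNReal.Tendsto.mul_const (ENNReal.tendsto_ofReal tendsto_one_div_add_atTop_nhds_zero_nat)
        (Or.inr (by finiteness))
    rw [ENNReal.ofReal_zero, zero_mul] at h1
    obtain ⟨j, hj⟩ := (h1.eventually (gt_mem_nhds (pos_iff_ne_zero.2 hε2))).exists
    exact ⟨j, hj.le⟩
  set M : ℝ≥0∞ := D * (1 + ENNReal.ofReal (ballConst n * (δ j ^ n)⁻¹) * K) with hM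
  have hMfin : M ≠ ⊤ := by finiteness
  obtain ⟨κ, hκ, hκM⟩ := exists_pos_mul_le (c := 2 ^ Q * M) (by finiteness) hε2
  refine ⟨κ, hκ, fun W hW hWK hDK A hA hAm hAκ => ?_⟩
  have hDW : Continuous fun x => ‖fderiv ℝ W x‖ₑ := (hW.continuous_fderiv one_ne_zero).enorm
  -- The averaging estimate needs a modular bound on all of ℝⁿ, while W is controlled only on B. For
  -- x in Ω the averages see only points of B, so nothing is lost.
  set a : Rn n → ℝ≥0∞ := B.indicator fun x => ‖W x‖ₑ
  set b : Rn n → ℝ≥0∞ := B.indicator fun x => ‖fderiv ℝ W x‖ₑ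
  have ham : Measurable a := hW.continuous.enorm.measurable.indicator hB
  have hbm : Measurable b := hDW.measurable.indicator hB
  have hind : ∀ φ : Rn n → ℝ≥0∞, ∫⁻ x, B.indicator φ x ^ q x = ∫⁻ x in B, φ x ^ q x := by
    intro φ
    rw [← lintegral_indicator hB]
    refine lintegral_congr fun x => ?_
    by_cases hx : x ∈ B
    · simp [hx]
    · simp [hx, ENNReal.zero_rpow_of_pos (hq.pos x)]
  have haK : ∫⁻ x, a x ^ q x ≤ K := (hind _).trans_le hWK
  have hbK : ∫⁻ x, b x ^ q x ≤ K := (hind _).trans_le hDK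
  set a₁ : Rn n → ℝ≥0∞ := fun x => ∫⁻ y, a (x - y) ∂bumpMeasure n j
  set b₁ : ℝ → Rn n → ℝ≥0∞ := fun t x => ∫⁻ y, b (x - t • y) ∂bumpMeasure n j
  set V : Rn n → ℝ≥0∞ := fun x => ∫⁻ t in Ioc (0 : ℝ) 1,
    ∫⁻ y, b (x - t • y) ^ q (x - t • y) ∂bumpMeasure n j
  have hprob : IsProbabilityMeasure (volume.restrict (Ioc (0 : ℝ) 1)) := ⟨by simp⟩
  have hpt : ∀ x ∈ Ω, ‖W x‖ₑ ≤ a₁ x + ENNReal.ofReal (δ j) * ∫⁻ t in Ioc (0 : ℝ) 1, b₁ t x := by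
    intro x hx
    have hswap : ∫⁻ t in Ioc (0 : ℝ) 1, b₁ t x =
        ∫⁻ y, (∫⁻ t in Ioc (0 : ℝ) 1, b (x - t • y)) ∂bumpMeasure n j :=
      lintegral_lintegral_swap (f := fun (t : ℝ) (y : Rn n) => b (x - t • y)) (by fun_prop)
    have hinner : Measurable fun y : Rn n => ∫⁻ t in Ioc (0 : ℝ) 1, b (x - t • y) :=
      Measurable.lintegral_prod_right' (f := fun z : Rn n × ℝ => b (x - z.2 • z.1)) (by fun_prop)
    rw [hswap, ← lintegral_const_mul _ hinner, ← lintegral_add_left (by fun_prop)]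
    -- The fundamental theorem of calculus on the segment from x - y to x is averaged over y.
    calc ‖W x‖ₑ = ∫⁻ _, ‖W x‖ₑ ∂bumpMeasure n j := by simp
      _ ≤ _ := by
        refine lintegral_mono_ae ?_
        filter_upwards [ae_bumpMeasure_norm_le (n := n) j] with y hy
        have hmem : ∀ t ∈ Ioc (0 : ℝ) 1, x - t • y ∈ B := by
          intro t ht
          refine hΩB x hx _ ?_
          rw [norm_smul, Real.norm_of_nonneg ht.1.le]
          exact mul_le_one₀ ht.2 (norm_nonneg _) (hy.trans (hδ1 j))
        have h1 : a (x - y) = ‖W (x - y)‖ₑ := by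
          have := hmem 1 ⟨zero_lt_one, le_rfl⟩
          rw [one_smul] at this
          exact indicator_of_mem this _
        have h2 : ∫⁻ t in Ioc (0 : ℝ) 1, b (x - t • y) =
            ∫⁻ t in Ioc (0 : ℝ) 1, ‖fderiv ℝ W (x - t • y)‖ₑ :=
          setLIntegral_congr_fun measurableSet_Ioc fun t ht => indicator_of_mem (hmem t ht) _
        have h3 : ‖y‖ₑ ≤ ENNReal.ofReal (δ j) := by
          rw [← ofReal_norm]
          exact ENNReal.ofReal_le_ofReal hy
        rw [h1, h2]
        calc ‖W x‖ₑ = ‖W (x - y) + (W x - W (x - y))‖ₑ := by rw [add_sub_cancel]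
          _ ≤ ‖W (x - y)‖ₑ + ‖W x - W (x - y)‖ₑ := enorm_add_le _ _
          _ ≤ _ := by
            gcongr
            exact (enorm_sub_le_lintegral_fderiv hW x y).trans (by gcongr)
  have hVm : Measurable V := by
    refine Measurable.lintegral_prod_right'
      (f := fun z : Rn n × ℝ => ∫⁻ y, b (z.1 - z.2 • y) ^ q (z.1 - z.2 • y) ∂bumpMeasure n j) ?_
    exact Measurable.lintegral_prod_right'
      (f := fun z : (Rn n × ℝ) × Rn n => b (z.1.1 - z.1.2 • z.2) ^ q (z.1.1 - z.1.2 • z.2))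
      (by fun_prop)
  have hV : ∫⁻ x, V x ≤ K := by
    simp only [V]
    rw [lintegral_lintegral_swap]
    · have h1 : ∀ t : ℝ, ∫⁻ x, ∫⁻ y, b (x - t • y) ^ q (x - t • y) ∂bumpMeasure n j =
          ∫⁻ x, b x ^ q x := fun t =>
        lintegral_lintegral_bumpMeasure j t (b := fun x => b x ^ q x) (by fun_prop)
      simp only [h1, lintegral_const, measure_univ, mul_one]
      exact hbK
    · exact (Measurable.lintegral_prod_right'
        (f := fun z : (Rn n × ℝ) × Rn n => b (z.1.1 - z.1.2 • z.2) ^ q (z.1.1 - z.1.2 • z.2))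
        (by fun_prop)).aemeasurable
  have ha₁ : ∀ x, a₁ x ^ q x ≤ M := by
    intro x
    have h1 := hD j 1 zero_lt_one le_rfl x a ham haK
    have h2 := lintegral_bumpMeasure_le j zero_lt_one x (a := fun y => a y ^ q y) (by fun_prop)
    simp only [one_smul, one_mul] at h1 h2
    refine h1.trans ?_
    rw [hM]
    gcongr
    exact h2.trans (by gcongr)
  have hb₁ : ∀ x, (∫⁻ t in Ioc (0 : ℝ) 1, b₁ t x) ^ q x ≤ D * (1 + V x) := by
    intro x
    have hm1 : Measurable fun t : ℝ => b₁ t x :=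
      Measurable.lintegral_prod_right' (f := fun z : ℝ × Rn n => b (x - z.1 • z.2)) (by fun_prop)
    have hm2 : Measurable fun t : ℝ =>
        ∫⁻ y, b (x - t • y) ^ q (x - t • y) ∂bumpMeasure n j :=
      Measurable.lintegral_prod_right'
        (f := fun z : ℝ × Rn n => b (x - z.1 • z.2) ^ q (x - z.1 • z.2)) (by fun_prop)
    refine (lintegral_rpow_le_of_isProbabilityMeasure hm1.aemeasurable (hq.one_le x)).trans ?_
    calc ∫⁻ t in Ioc (0 : ℝ) 1, b₁ t x ^ q x
        ≤ ∫⁻ t in Ioc (0 : ℝ) 1,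
            D * (1 + ∫⁻ y, b (x - t • y) ^ q (x - t • y) ∂bumpMeasure n j) :=
          setLIntegral_mono' measurableSet_Ioc fun t ht => hD j t ht.1 ht.2 x b hbm hbK
      _ = D * (1 + V x) := by
          rw [lintegral_const_mul _ (hm2.const_add _), lintegral_add_left measurable_const]
          simp [V]
  have hfinal : ∀ x ∈ Ω, ‖W x‖ₑ ^ q x ≤
      2 ^ Q * M + ENNReal.ofReal (δ j) * (2 ^ Q * (D * (1 + V x))) := by
    intro x hx
    have h2Q : (2 : ℝ≥0∞) ^ (q x - 1) ≤ 2 ^ Q :=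
      ENNReal.rpow_le_rpow_of_exponent_le one_le_two (by linarith [hq.le_bound x])
    have hδq : ENNReal.ofReal (δ j) ^ q x ≤ ENNReal.ofReal (δ j) :=
      rpow_le_of_le_one (by simpa using hδ1 j) (hq.one_le x)
    calc ‖W x‖ₑ ^ q x
        ≤ (a₁ x + ENNReal.ofReal (δ j) * ∫⁻ t in Ioc (0 : ℝ) 1, b₁ t x) ^ q x :=
          ENNReal.rpow_le_rpow (hpt x hx) (hq.pos x).le
      _ ≤ 2 ^ (q x - 1) * (a₁ x ^ q x +
            (ENNReal.ofReal (δ j) * ∫⁻ t in Ioc (0 : ℝ) 1, b₁ t x) ^ q x) :=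
          ENNReal.rpow_add_le_mul_rpow_add_rpow _ _ (hq.one_le x)
      _ ≤ 2 ^ Q * (M + ENNReal.ofReal (δ j) * (D * (1 + V x))) := by
          rw [ENNReal.mul_rpow_of_nonneg _ _ (hq.pos x).le]
          gcongr
          · exact ha₁ x
          · exact hb₁ x
      _ = _ := by ring
  calc ∫⁻ x in A, ‖W x‖ₑ ^ q x
      ≤ ∫⁻ x in A, (2 ^ Q * M + ENNReal.ofReal (δ j) * (2 ^ Q * (D * (1 + V x)))) :=
        setLIntegral_mono' hAm fun x hx => hfinal x (hA hx)
    _ = 2 ^ Q * M * volume A +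
          ENNReal.ofReal (δ j) * (2 ^ Q * (D * (volume A + ∫⁻ x in A, V x))) := by
        rw [lintegral_add_left measurable_const, setLIntegral_const,
          lintegral_const_mul _ (by fun_prop), lintegral_const_mul _ (by fun_prop),
          lintegral_const_mul _ (by fun_prop), lintegral_add_left measurable_const,
          setLIntegral_const, one_mul]
    _ ≤ ε / 2 + ε / 2 := by
        gcongr
        · exact (mul_le_mul_right hAκ _).trans hκM
        · refine le_trans ?_ hj
          gcongr
          exact (setLIntegral_le_lintegral _ _).trans hV
    _ = ε := ENNReal.add_halves ε

/-- Functions in a bounded subset of `W^{1,q(·)}(ℝⁿ)` have equi-integrable `q(·)`-th powers on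
bounded sets. -/
lemma RegularExponent.exists_equiintegrable (hq : RegularExponent q Q C)
    {Ω : Set (Rn n)} (hΩ : Bornology.IsBounded Ω) (K : ℝ≥0) {ε : ℝ≥0∞} (hε : ε ≠ 0) :
    ∃ κ : ℝ≥0∞, 0 < κ ∧ ∀ (w : Rn n → ℝ) (k : Rn n → Rn n), Measurable w → Measurable k →
      (∀ i, HasWeakPartial univ w i fun x => k x i) →
      ∫⁻ x, ‖w x‖ₑ ^ q x ≤ K → ∫⁻ x, ‖k x‖ₑ ^ q x ≤ K →
      ∀ A ⊆ Ω, MeasurableSet A → volume A ≤ κ → ∫⁻ x in A, ‖w x‖ₑ ^ q x ≤ ε := by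
  have hqm := hq.cont.measurable
  obtain ⟨D, hD⟩ := hq.lintegral_bumpMeasure_rpow_le K
  obtain ⟨R, hR⟩ := hΩ.subset_closedBall 0
  set B : Set (Rn n) := Metric.closedBall 0 (R + 1)
  have hBfin : volume B ≠ ⊤ := measure_closedBall_lt_top.ne
  have hΩB : ∀ x ∈ Ω, ∀ y : Rn n, ‖y‖ ≤ 1 → x - y ∈ B := by
    intro x hx y hy
    have := hR hx
    rw [mem_closedBall_zero_iff] at this ⊢
    exact (norm_sub_le _ _).trans (add_le_add this hy)
  obtain ⟨κ, hκ, h⟩ := hq.exists_equiintegrable_contDiff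
    (ne_top_of_le_ne_top measure_closedBall_lt_top.ne (measure_mono hR))
    Metric.isClosed_closedBall.measurableSet hΩB (D * (volume B + K)).toNNReal hε
  rw [ENNReal.coe_toNNReal (by finiteness)] at h
  refine ⟨κ, hκ, fun w k hw hk hwk hwK hkK A hA hAm hAκ => ?_⟩
  -- The constant 1 in the averaging estimate is not integrable over ℝⁿ; hence the restriction to
  -- the ball B.
  have hbound : ∀ (j : ℕ) (a : Rn n → ℝ≥0∞), Measurable a → ∫⁻ x, a x ^ q x ≤ K →
      ∫⁻ x in B, (∫⁻ y, a (x - y) ∂bumpMeasure n j) ^ q x ≤ D * (volume B + K) := by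
    intro j a ha haK
    have hm : Measurable fun x => ∫⁻ y, a (x - y) ^ q (x - y) ∂bumpMeasure n j :=
      Measurable.lintegral_prod_right'
        (f := fun z : Rn n × Rn n => a (z.1 - z.2) ^ q (z.1 - z.2)) (by fun_prop)
    have hT := lintegral_lintegral_bumpMeasure j 1 (b := fun y => a y ^ q y) (by fun_prop)
    simp only [one_smul] at hT
    calc ∫⁻ x in B, (∫⁻ y, a (x - y) ∂bumpMeasure n j) ^ q x
        ≤ ∫⁻ x in B, D * (1 + ∫⁻ y, a (x - y) ^ q (x - y) ∂bumpMeasure n j) := by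
          refine lintegral_mono fun x => ?_
          simpa only [one_smul] using hD j 1 zero_lt_one le_rfl x a ha haK
      _ = D * (volume B + ∫⁻ x in B, ∫⁻ y, a (x - y) ^ q (x - y) ∂bumpMeasure n j) := by
          rw [lintegral_const_mul _ (by fun_prop), lintegral_add_left measurable_const,
            setLIntegral_const, one_mul]
      _ ≤ D * (volume B + K) := by
          gcongr
          exact (setLIntegral_le_lintegral _ _).trans (hT.trans_le haK)
  have hwl : LocallyIntegrable w := hq.locallyIntegrable hw (ne_top_of_le_ne_top (by simp) hwK)
  have hkl : LocallyIntegrable k := hq.locallyIntegrable hk (ne_top_of_le_ne_top (by simp) hkK)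
  have hgrad : ∀ j x, ‖fderiv ℝ (mollify j w) x‖ₑ ≤ ‖mollify j k x‖ₑ := by
    intro j x
    have : fderiv ℝ (mollify j w) x = innerSL ℝ (mollify j k x) := by
      refine ContinuousLinearMap.coe_injective ((EuclideanSpace.basisFun (Fin n) ℝ).toBasis.ext ?_)
      intro i
      have := fderiv_mollify_of_hasWeakPartial j (hwk i) x
      rw [← mollify_apply j hkl] at this
      simpa [EuclideanSpace.inner_single_right] using this
    rw [this, ← ofReal_norm, ← ofReal_norm, innerSL_apply_norm]
  have hsmooth : ∀ j, ∫⁻ x in A, ‖mollify j w x‖ₑ ^ q x ≤ ε := by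
    intro j
    refine h _ ((contDiff_mollify j hwl).of_le (by exact_mod_cast le_top)) ?_ ?_ A hA hAm hAκ
    · refine le_trans (lintegral_mono fun x => ?_) (hbound j _ hw.enorm hwK)
      exact ENNReal.rpow_le_rpow (enorm_mollify_le j w x) (hq.pos x).le
    · refine le_trans (lintegral_mono fun x => ?_) (hbound j _ hk.enorm hkK)
      exact ENNReal.rpow_le_rpow ((hgrad j x).trans (enorm_mollify_le j k x)) (hq.pos x).le
  -- The bound for the mollifications is uniform in j, so it passes to w by Fatou's lemma.
  have hlim : ∀ᵐ x ∂volume.restrict A,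
      ‖w x‖ₑ ^ q x = liminf (fun j => ‖mollify j w x‖ₑ ^ q x) atTop := by
    refine ae_restrict_of_ae ?_
    filter_upwards [ae_tendsto_mollify hwl] with x hx
    exact (((ENNReal.continuous_rpow_const.tendsto _).comp hx.enorm).liminf_eq).symm
  rw [lintegral_congr_ae hlim]
  refine (lintegral_liminf_le' fun j => ?_).trans ?_
  · have := (contDiff_mollify j hwl).continuous.measurable
    fun_prop
  · exact liminf_le_of_frequently_le' (Eventually.of_forall hsmooth).frequently

end

/-! ### Modulars against Luxemburg norms; calculus of weak derivatives -/

section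

/-! ### Norms and modulars -/

variable {n : ℕ} {q : Rn n → ℝ} {Q C : ℝ} {E : Type*} [NormedAddCommGroup E] {S : Set (Rn n)}

lemma RegularExponent.bound_nonneg (hq : RegularExponent q Q C) : 0 ≤ Q :=
  (hq.pos 0).le.trans (hq.le_bound 0)

lemma RegularExponent.phi_div (hq : RegularExponent q Q C) (x : Rn n) (ξ : E) {t : ℝ}
    (ht : 0 < t) : phi q x |‖ξ‖ / t| = (‖ξ‖ₑ / ENNReal.ofReal t) ^ q x / ENNReal.ofReal (q x) := by
  rw [phi, abs_of_nonneg (by positivity), ENNReal.ofReal_div_of_pos (hq.pos x),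
    ← ENNReal.ofReal_rpow_of_nonneg (by positivity) (hq.pos x).le, ENNReal.ofReal_div_of_pos ht,
    ofReal_norm]

lemma RegularExponent.modular_le (hq : RegularExponent q Q C) (w : Rn n → E) {t : ℝ}
    (ht : 0 < t) :
    modular S (phi q) (fun x => ‖w x‖ / t) ≤ ∫⁻ x in S, (‖w x‖ₑ / ENNReal.ofReal t) ^ q x := by
  refine lintegral_mono fun x => ?_
  rw [hq.phi_div x _ ht]
  refine ENNReal.div_le_of_le_mul (le_mul_of_one_le_right' ?_)
  simpa using hq.one_le x

/-- The factor Q compensates the division by q(x) in `phi`. -/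
lemma RegularExponent.le_modular (hq : RegularExponent q Q C) (w : Rn n → E) {t : ℝ}
    (ht : 0 < t) :
    ∫⁻ x in S, (‖w x‖ₑ / ENNReal.ofReal t) ^ q x ≤
      ENNReal.ofReal Q * modular S (phi q) (fun x => ‖w x‖ / t) := by
  rw [modular, ← lintegral_const_mul' _ _ ENNReal.ofReal_ne_top]
  refine lintegral_mono fun x => ?_
  rw [hq.phi_div x _ ht]
  have h0 : ENNReal.ofReal (q x) ≠ 0 := by simpa using hq.pos x
  calc (‖w x‖ₑ / ENNReal.ofReal t) ^ q x
      = ENNReal.ofReal (q x) * ((‖w x‖ₑ / ENNReal.ofReal t) ^ q x / ENNReal.ofReal (q x)) :=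
        (ENNReal.mul_div_cancel h0 ENNReal.ofReal_ne_top).symm
    _ ≤ _ := by
        gcongr
        exact hq.le_bound x

lemma RegularExponent.lintegral_const_mul_rpow_le (hq : RegularExponent q Q C) {c : ℝ≥0∞}
    (hc : 1 ≤ c) (hc' : c ≠ ⊤) (a : Rn n → ℝ≥0∞) :
    ∫⁻ x in S, (c * a x) ^ q x ≤ c ^ Q * ∫⁻ x in S, a x ^ q x := by
  rw [← lintegral_const_mul' _ _ (ENNReal.rpow_ne_top_of_nonneg hq.bound_nonneg hc')]
  refine lintegral_mono fun x => ?_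
  rw [ENNReal.mul_rpow_of_nonneg _ _ (hq.pos x).le]
  gcongr
  exact hq.le_bound x

lemma RegularExponent.lintegral_mul_rpow_le_of_le_one (hq : RegularExponent q Q C) {c : ℝ≥0∞}
    (hc : c ≤ 1) (a : Rn n → ℝ≥0∞) :
    ∫⁻ x in S, (c * a x) ^ q x ≤ c * ∫⁻ x in S, a x ^ q x := by
  rw [← lintegral_const_mul' _ _ (ne_top_of_le_ne_top ENNReal.one_ne_top hc)]
  refine lintegral_mono fun x => ?_
  rw [ENNReal.mul_rpow_of_nonneg _ _ (hq.pos x).le]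
  gcongr
  exact rpow_le_of_le_one hc (hq.one_le x)

lemma luxNorm_le {φ : Rn n → ℝ → ℝ≥0∞} {w : Rn n → E} {t : ℝ} (ht : 0 < t)
    (h : modular S φ (fun x => ‖w x‖ / t) ≤ 1) : luxNorm S φ w ≤ ENNReal.ofReal t :=
  sInf_le ⟨t, ht, h, rfl⟩

lemma RegularExponent.lpNorm_le (hq : RegularExponent q Q C) {w : Rn n → E} {t : ℝ}
    (ht : 1 ≤ t) (h : ∫⁻ x in S, ‖w x‖ₑ ^ q x ≤ ENNReal.ofReal t) :
    lpNorm S q w ≤ ENNReal.ofReal t := by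
  have ht0 : 0 < t := by linarith
  refine luxNorm_le ht0 ((hq.modular_le w ht0).trans ?_)
  have h1 : (ENNReal.ofReal t)⁻¹ ≤ 1 := ENNReal.inv_le_one.2 (by simpa using ht)
  simp only [div_eq_mul_inv, mul_comm _ (ENNReal.ofReal t)⁻¹]
  refine (hq.lintegral_mul_rpow_le_of_le_one h1 _).trans ?_
  refine (mul_le_mul_right h _).trans_eq ?_
  exact ENNReal.inv_mul_cancel (by simpa using ht0) ENNReal.ofReal_ne_top

lemma RegularExponent.lintegral_rpow_le_of_lpNorm_lt (hq : RegularExponent q Q C) {w : Rn n → E}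
    {t : ℝ} (ht : 1 ≤ t) (h : lpNorm S q w < ENNReal.ofReal t) :
    ∫⁻ x in S, ‖w x‖ₑ ^ q x ≤ ENNReal.ofReal t ^ Q * ENNReal.ofReal Q := by
  obtain ⟨_, ⟨s, hs, hmod, rfl⟩, hst⟩ := sInf_lt_iff.1 h
  have hs0 : ENNReal.ofReal s ≠ 0 := by simpa using hs
  calc ∫⁻ x in S, ‖w x‖ₑ ^ q x
      ≤ ∫⁻ x in S, (ENNReal.ofReal t * (‖w x‖ₑ / ENNReal.ofReal s)) ^ q x := by
        refine lintegral_mono fun x => ?_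
        refine ENNReal.rpow_le_rpow ?_ (hq.pos x).le
        calc ‖w x‖ₑ = ENNReal.ofReal s * (‖w x‖ₑ / ENNReal.ofReal s) :=
              (ENNReal.mul_div_cancel hs0 ENNReal.ofReal_ne_top).symm
          _ ≤ _ := by gcongr
    _ ≤ ENNReal.ofReal t ^ Q * ∫⁻ x in S, (‖w x‖ₑ / ENNReal.ofReal s) ^ q x :=
        hq.lintegral_const_mul_rpow_le (by simpa using ht) ENNReal.ofReal_ne_top _
    _ ≤ ENNReal.ofReal t ^ Q * (ENNReal.ofReal Q * 1) := by
        gcongr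
        exact (hq.le_modular w hs).trans (by gcongr)
    _ = _ := by rw [mul_one]

/-- For a bounded exponent, rescaling changes the modular by a finite factor, so the scale can be
taken to be 1. -/
lemma RegularExponent.memL_iff (hq : RegularExponent q Q C) {w : Rn n → E} :
    MemL S q w ↔ AEStronglyMeasurable w (volume.restrict S) ∧ ∫⁻ x in S, ‖w x‖ₑ ^ q x < ⊤ := by
  refine and_congr_right fun _ => ⟨?_, fun h => ⟨1, one_pos, ?_⟩⟩
  · rintro ⟨t, ht, h⟩
    have ht' : 0 < t⁻¹ := inv_pos.2 ht
    have h0 : ENNReal.ofReal t⁻¹ ≠ 0 := by simpa using ht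
    have h1 : ∫⁻ x in S, (‖w x‖ₑ / ENNReal.ofReal t⁻¹) ^ q x < ⊤ := by
      refine (hq.le_modular w ht').trans_lt (ENNReal.mul_lt_top ENNReal.ofReal_lt_top ?_)
      simpa only [div_inv_eq_mul, mul_comm _ t] using h
    have hc : max 1 (ENNReal.ofReal t⁻¹) ≠ ⊤ := by simp
    refine lt_of_le_of_lt ?_ (ENNReal.mul_lt_top
      (ENNReal.rpow_lt_top_of_nonneg hq.bound_nonneg hc) h1)
    refine le_trans (lintegral_mono fun x => ?_)
      (hq.lintegral_const_mul_rpow_le (le_max_left _ _) hc _)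
    refine ENNReal.rpow_le_rpow ?_ (hq.pos x).le
    calc ‖w x‖ₑ = ENNReal.ofReal t⁻¹ * (‖w x‖ₑ / ENNReal.ofReal t⁻¹) :=
          (ENNReal.mul_div_cancel h0 ENNReal.ofReal_ne_top).symm
      _ ≤ _ := by
          gcongr
          exact le_max_right _ _
  · have h1 := hq.modular_le (S := S) w one_pos
    simp only [div_one, ENNReal.ofReal_one] at h1
    simpa using h1.trans_lt h

lemma RegularExponent.tendsto_lpNorm (hq : RegularExponent q Q C) {w : ℕ → Rn n → E}
    (h : Tendsto (fun j => ∫⁻ x in S, ‖w j x‖ₑ ^ q x) atTop (𝓝 0)) :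
    Tendsto (fun j => lpNorm S q (w j)) atTop (𝓝 0) := by
  rw [ENNReal.tendsto_nhds_zero]
  intro ε hε
  obtain ⟨r, hr0, hrε⟩ : ∃ r : ℝ≥0, 0 < r ∧ (r : ℝ≥0∞) < min ε 1 :=
    (ENNReal.lt_iff_exists_nnreal_btwn.1 (lt_min hε zero_lt_one)).imp
      fun r hr => ⟨by exact_mod_cast hr.1, hr.2⟩
  have hr1 : (r : ℝ≥0∞) ≤ 1 := hrε.le.trans (min_le_right _ _)
  have hr0' : (r : ℝ≥0∞) ≠ 0 := by exact_mod_cast hr0.ne'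
  have hc : ((r : ℝ≥0∞)⁻¹) ^ Q ≠ ⊤ :=
    ENNReal.rpow_ne_top_of_nonneg hq.bound_nonneg (ENNReal.inv_ne_top.2 hr0')
  have h1 := ENNReal.Tendsto.const_mul h (Or.inr hc)
  rw [mul_zero] at h1
  filter_upwards [ENNReal.tendsto_nhds_zero.1 h1 1 zero_lt_one] with j hj
  refine le_trans ?_ (hrε.le.trans (min_le_left _ _))
  rw [← ENNReal.ofReal_coe_nnreal]
  refine luxNorm_le (by exact_mod_cast hr0) ((hq.modular_le _ (by exact_mod_cast hr0)).trans ?_)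
  rw [ENNReal.ofReal_coe_nnreal]
  simp only [div_eq_mul_inv, mul_comm _ (r : ℝ≥0∞)⁻¹]
  exact (hq.lintegral_const_mul_rpow_le (ENNReal.one_le_inv.2 hr1)
    (ENNReal.inv_ne_top.2 hr0') _).trans hj

lemma RegularExponent.lintegral_le_lpNorm_mul (hq : RegularExponent q Q C) (w : Rn n → E)
    (hS : volume S ≠ ⊤) :
    ∫⁻ x in S, ‖w x‖ₑ ≤ lpNorm S q w * (volume S + ENNReal.ofReal Q) := by
  have hfin : volume S + ENNReal.ofReal Q ≠ ⊤ := by finiteness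
  have hpos : volume S + ENNReal.ofReal Q ≠ 0 := by
    have : 0 < Q := (hq.pos 0).trans_le (hq.le_bound 0)
    simp [this]
  rw [← ENNReal.div_le_iff hpos hfin]
  refine le_sInf ?_
  rintro _ ⟨t, ht, hmod, rfl⟩
  rw [ENNReal.div_le_iff hpos hfin]
  have ht0 : ENNReal.ofReal t ≠ 0 := by simpa using ht
  calc ∫⁻ x in S, ‖w x‖ₑ = ∫⁻ x in S, ENNReal.ofReal t * (‖w x‖ₑ / ENNReal.ofReal t) :=
        lintegral_congr fun x => (ENNReal.mul_div_cancel ht0 ENNReal.ofReal_ne_top).symm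
    _ = ENNReal.ofReal t * ∫⁻ x in S, ‖w x‖ₑ / ENNReal.ofReal t :=
        lintegral_const_mul' _ _ ENNReal.ofReal_ne_top
    _ ≤ ENNReal.ofReal t * ∫⁻ x in S, (1 + (‖w x‖ₑ / ENNReal.ofReal t) ^ q x) := by
        gcongr with x
        exact le_one_add_rpow (hq.one_le x)
    _ ≤ ENNReal.ofReal t * (volume S + ENNReal.ofReal Q * 1) := by
        rw [lintegral_add_left measurable_const, setLIntegral_const, one_mul]
        gcongr
        exact (hq.le_modular w ht).trans (by gcongr)
    _ = _ := by rw [mul_one]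

lemma RegularExponent.lintegral_sub_rpow_le (hq : RegularExponent q Q C) {v w : Rn n → E}
    (hv : AEStronglyMeasurable v (volume.restrict S)) :
    ∫⁻ x in S, ‖v x - w x‖ₑ ^ q x ≤
      2 ^ Q * ((∫⁻ x in S, ‖v x‖ₑ ^ q x) + ∫⁻ x in S, ‖w x‖ₑ ^ q x) := by
  have hqm := hq.cont.measurable
  have hQ : (2 : ℝ≥0∞) ^ Q ≠ ⊤ := ENNReal.rpow_ne_top_of_nonneg hq.bound_nonneg (by simp)
  have hvm : AEMeasurable (fun x => ‖v x‖ₑ ^ q x) (volume.restrict S) :=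
    hv.enorm.pow hqm.aemeasurable
  rw [← lintegral_add_left' hvm, ← lintegral_const_mul' _ _ hQ]
  refine lintegral_mono fun x => ?_
  calc ‖v x - w x‖ₑ ^ q x ≤ (‖v x‖ₑ + ‖w x‖ₑ) ^ q x :=
        ENNReal.rpow_le_rpow enorm_sub_le (hq.pos x).le
    _ ≤ 2 ^ (q x - 1) * (‖v x‖ₑ ^ q x + ‖w x‖ₑ ^ q x) :=
        ENNReal.rpow_add_le_mul_rpow_add_rpow _ _ (hq.one_le x)
    _ ≤ _ := by
        gcongr
        · exact one_le_two
        · linarith [hq.le_bound x]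

/-! ### Algebra of weak derivatives -/

variable {Ω : Set (Rn n)}

lemma integrableOn_mul_of_tsupport_subset {u φ : Rn n → ℝ} (hu : LocallyIntegrableOn u Ω)
    (hφ : Continuous φ) (hc : HasCompactSupport φ) (hs : tsupport φ ⊆ Ω) :
    IntegrableOn (fun x => u x * φ x) Ω := by
  have h1 : IntegrableOn (fun x => u x * φ x) (tsupport φ) :=
    (hu.integrableOn_compact_subset hs hc).mul_continuousOn hφ.continuousOn hc
  refine ((integrableOn_iff_integrable_of_support_subset ?_).1 h1).integrableOn
  exact (Function.support_mul_subset_right _ _).trans (subset_tsupport _)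

lemma tsupport_fderiv_apply_subset_tsupport {η : Rn n → ℝ} (v : Rn n) :
    tsupport (fun x => fderiv ℝ η x v) ⊆ tsupport η :=
  (closure_mono fun x hx => by
    simp only [Function.mem_support] at hx ⊢
    intro h
    simp [h] at hx).trans (tsupport_fderiv_subset ℝ)

lemma HasWeakPartial.sub {u v g k : Rn n → ℝ} {i : Fin n} (hu : HasWeakPartial Ω u i g)
    (hv : HasWeakPartial Ω v i k) : HasWeakPartial Ω (u - v) i (g - k) := by
  refine ⟨hu.1.sub hv.1, hu.2.1.sub hv.2.1, fun η hη hc hs => ?_⟩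
  have hd : Continuous fun x => fderiv ℝ η x (EuclideanSpace.single i 1) :=
    (hη.continuous_fderiv (by simp)).clm_apply continuous_const
  have hdc : HasCompactSupport fun x => fderiv ℝ η x (EuclideanSpace.single i 1) :=
    hc.mono' ((subset_tsupport _).trans (tsupport_fderiv_apply_subset_tsupport _))
  have hds := (tsupport_fderiv_apply_subset_tsupport (η := η) (EuclideanSpace.single i 1)).trans hs
  simp only [Pi.sub_apply, sub_mul]
  rw [integral_sub (integrableOn_mul_of_tsupport_subset hu.1 hd hdc hds)
    (integrableOn_mul_of_tsupport_subset hv.1 hd hdc hds), integral_sub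
    (integrableOn_mul_of_tsupport_subset hu.2.1 hη.continuous hc hs)
    (integrableOn_mul_of_tsupport_subset hv.2.1 hη.continuous hc hs), hu.2.2 η hη hc hs,
    hv.2.2 η hη hc hs]
  ring

lemma HasWeakPartial.const_smul {u g : Rn n → ℝ} {i : Fin n} (c : ℝ)
    (hu : HasWeakPartial Ω u i g) : HasWeakPartial Ω (c • u) i (c • g) := by
  refine ⟨hu.1.smul c, hu.2.1.smul c, fun η hη hc hs => ?_⟩
  simp only [Pi.smul_apply, smul_eq_mul, mul_assoc, integral_const_mul, hu.2.2 η hη hc hs]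
  ring

lemma HasWeakPartial.congr_ae {u v g k : Rn n → ℝ} {i : Fin n} (hu : HasWeakPartial Ω u i g)
    (huv : u =ᵐ[volume.restrict Ω] v) (hgk : g =ᵐ[volume.restrict Ω] k) :
    HasWeakPartial Ω v i k := by
  refine ⟨hu.1.congr huv, hu.2.1.congr hgk, fun η hη hc hs => ?_⟩
  have h1 : ∫ x in Ω, u x * fderiv ℝ η x (EuclideanSpace.single i 1) =
      ∫ x in Ω, v x * fderiv ℝ η x (EuclideanSpace.single i 1) :=
    integral_congr_ae (huv.mono fun x hx => by simp only [hx])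
  have h2 : ∫ x in Ω, g x * η x = ∫ x in Ω, k x * η x :=
    integral_congr_ae (hgk.mono fun x hx => by simp only [hx])
  rw [← h1, ← h2, hu.2.2 η hη hc hs]

/-- Test functions supported in Ω are admissible for both derivatives, so the fundamental lemma of
the calculus of variations applies. It identifies the gradient of an extension inside Ω. -/
lemma HasWeakPartial.ae_eq (hΩ : IsOpen Ω) {u v g k : Rn n → ℝ} {i : Fin n}
    (hu : HasWeakPartial univ u i g) (hv : HasWeakPartial Ω v i k)
    (huv : u =ᵐ[volume.restrict Ω] v) : g =ᵐ[volume.restrict Ω] k := by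
  have hg : LocallyIntegrableOn g Ω := hu.2.1.mono_set (subset_univ _)
  have h := hΩ.ae_eq_zero_of_integral_contDiff_smul_eq_zero (hg.sub hv.2.1)
    (fun η hη hc hs => ?_)
  · rw [EventuallyEq, ae_restrict_iff' hΩ.measurableSet]
    filter_upwards [h] with x hx hxΩ
    simpa [sub_eq_zero] using hx hxΩ
  · have hds := (tsupport_fderiv_apply_subset_tsupport (η := η) (EuclideanSpace.single i 1)).trans hs
    have h1 := hu.2.2 η hη hc (subset_univ _)
    rw [Measure.restrict_univ] at h1
    have h2 : ∫ x, u x * fderiv ℝ η x (EuclideanSpace.single i 1) =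
        ∫ x in Ω, v x * fderiv ℝ η x (EuclideanSpace.single i 1) := by
      rw [← setIntegral_eq_integral_of_forall_compl_eq_zero (s := Ω)]
      · exact integral_congr_ae (huv.mono fun x hx => by simp only [hx])
      · intro x hx
        rw [image_eq_zero_of_notMem_tsupport
          (f := fun x => fderiv ℝ η x (EuclideanSpace.single i 1)) (fun h => hx (hds h)), mul_zero]
    have h3 : ∀ f : Rn n → ℝ, ∫ x, f x * η x = ∫ x in Ω, f x * η x := fun f =>
      (setIntegral_eq_integral_of_forall_compl_eq_zero fun x hx => by
        rw [image_eq_zero_of_notMem_tsupport (fun h => hx (hs h)), mul_zero]).symm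
    rw [h2, hv.2.2 η hη hc hs, h3, neg_inj] at h1
    have h4 : ∀ x, η x • (g - k) x = (g - k) x * η x := fun x => by
      rw [smul_eq_mul, mul_comm]
    simp only [h4]
    rw [h3]
    simp only [Pi.sub_apply, sub_mul]
    rw [integral_sub (integrableOn_mul_of_tsupport_subset hg hη.continuous hc hs)
      (integrableOn_mul_of_tsupport_subset hv.2.1 hη.continuous hc hs), h1, sub_self]

lemma IsSobolev.sub (hq : RegularExponent q Q C) {u v : Rn n → ℝ} {g k : Rn n → Rn n}
    (hu : IsSobolev Ω q u g) (hv : IsSobolev Ω q v k) : IsSobolev Ω q (u - v) (g - k) := by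
  have hQ : (2 : ℝ≥0∞) ^ Q < ⊤ := ENNReal.rpow_lt_top_of_nonneg hq.bound_nonneg (by simp)
  refine ⟨hq.memL_iff.2 ⟨hu.1.1.sub hv.1.1, ?_⟩, hq.memL_iff.2 ⟨hu.2.1.1.sub hv.2.1.1, ?_⟩,
    fun i => (hu.2.2 i).sub (hv.2.2 i)⟩
  · exact (hq.lintegral_sub_rpow_le hu.1.1).trans_lt (ENNReal.mul_lt_top hQ (ENNReal.add_lt_top.2
      ⟨(hq.memL_iff.1 hu.1).2, (hq.memL_iff.1 hv.1).2⟩))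
  · exact (hq.lintegral_sub_rpow_le hu.2.1.1).trans_lt (ENNReal.mul_lt_top hQ (ENNReal.add_lt_top.2
      ⟨(hq.memL_iff.1 hu.2.1).2, (hq.memL_iff.1 hv.2.1).2⟩))

lemma IsSobolev.const_smul (hq : RegularExponent q Q C) {c : ℝ} (hc : ‖c‖ₑ ≤ 1) {u : Rn n → ℝ}
    {g : Rn n → Rn n} (hu : IsSobolev Ω q u g) : IsSobolev Ω q (c • u) (c • g) := by
  refine ⟨hq.memL_iff.2 ⟨hu.1.1.const_smul c, ?_⟩, hq.memL_iff.2 ⟨hu.2.1.1.const_smul c, ?_⟩,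
    fun i => (hu.2.2 i).const_smul c⟩
  · simp only [Pi.smul_apply, enorm_smul]
    exact (hq.lintegral_mul_rpow_le_of_le_one hc _).trans_lt
      (ENNReal.mul_lt_top (hc.trans_lt ENNReal.one_lt_top) (hq.memL_iff.1 hu.1).2)
  · simp only [Pi.smul_apply, enorm_smul]
    exact (hq.lintegral_mul_rpow_le_of_le_one hc _).trans_lt
      (ENNReal.mul_lt_top (hc.trans_lt ENNReal.one_lt_top) (hq.memL_iff.1 hu.2.1).2)

end

/-! ### From extension to an Ehrling-type inequality -/

section

/-! ### Extension to the whole space -/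

variable {n : ℕ} {p q : Rn n → ℝ} {Q C : ℝ} {Ω : Set (Rn n)}

section Congr

variable {m : ℕ} {E : Type*} [NormedAddCommGroup E]

lemma modular_phi_congr (hΩ : MeasurableSet Ω) (h : EqOn q p Ω) (w : Rn n → ℝ) :
    modular Ω (phi q) w = modular Ω (phi p) w :=
  setLIntegral_congr_fun hΩ fun x hx => by simp only [phi, h hx]

lemma lpNorm_congr (hΩ : MeasurableSet Ω) (h : EqOn q p Ω) (w : Rn n → E) :
    lpNorm Ω q w = lpNorm Ω p w := by
  simp only [lpNorm, luxNorm, modular_phi_congr hΩ h]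

lemma memL_congr (hΩ : MeasurableSet Ω) (h : EqOn q p Ω) (w : Rn n → E) :
    MemL Ω q w ↔ MemL Ω p w := by
  simp only [MemL, modular_phi_congr hΩ h]

lemma energy_congr (hΩ : MeasurableSet Ω) (h : EqOn q p Ω) (f : Mat m n → ℝ)
    (G : Rn n → Mat m n) : energy Ω q f G = energy Ω p f G :=
  setLIntegral_congr_fun hΩ fun x hx => by simp only [h hx]

lemma relaxed_congr (hΩ : MeasurableSet Ω) (h : EqOn q p Ω) (f : Mat m n → ℝ) (u : Rn n → Rn m) :
    relaxed Ω q f u = relaxed Ω p f u := by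
  simp only [relaxed, IsSobolevVec, memL_congr hΩ h, lpNorm_congr hΩ h, energy_congr hΩ h]

lemma relaxedSmooth_congr (hΩ : MeasurableSet Ω) (h : EqOn q p Ω) (f : Mat m n → ℝ)
    (u : Rn n → Rn m) : relaxedSmooth Ω q f u = relaxedSmooth Ω p f u := by
  simp only [relaxedSmooth, energy_congr hΩ h]

end Congr

/-- Bounded sets of Sobolev functions on `Ω` extend to bounded sets of Sobolev functions on
`ℝⁿ`, where boundedness is understood in terms of modulars. -/
def BoundedExtension (Ω : Set (Rn n)) (q : Rn n → ℝ) : Prop :=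
  ∀ K : ℝ≥0, ∃ K' : ℝ≥0, ∀ u g, IsSobolev Ω q u g → ∫⁻ x in Ω, ‖u x‖ₑ ^ q x ≤ K →
    ∫⁻ x in Ω, ‖g x‖ₑ ^ q x ≤ K → ∃ (w : Rn n → ℝ) (k : Rn n → Rn n), Measurable w ∧ Measurable k ∧
      (∀ i, HasWeakPartial univ w i fun x => k x i) ∧ w =ᵐ[volume.restrict Ω] u ∧
      k =ᵐ[volume.restrict Ω] g ∧ ∫⁻ x, ‖w x‖ₑ ^ q x ≤ K' ∧ ∫⁻ x, ‖k x‖ₑ ^ q x ≤ K'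

/-- A modular bound gives a norm bound, the operator preserves norm bounds up to its constant, and
boundedness of the exponent turns the norm bound back into a modular bound. -/
lemma IsExtensionDomain.exists_boundedExtension (hΩ : IsOpen Ω) (h : IsExtensionDomain Ω p) :
    ∃ q Q C, RegularExponent q Q C ∧ EqOn q p Ω ∧ BoundedExtension Ω q := by
  obtain ⟨q, hq1, hql, hqp, T, A, -, -, hT⟩ := h
  obtain ⟨Q, C, hq⟩ := hql.exists_regularExponent hq1
  have hcongr : ∀ u g, IsSobolev Ω q u g ↔ IsSobolev Ω p u g := fun u g => by
    simp only [IsSobolev, memL_congr hΩ.measurableSet hqp]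
  refine ⟨q, Q, C, hq, hqp, fun K => ?_⟩
  set t : ℝ≥0 := max 1 K
  -- The summand 1 makes the norm strictly smaller than s: the norm is an infimum, and an admissible
  -- scale below s is needed.
  set s : ℝ≥0 := A * (t + t) + 1
  have hs1 : (1 : ℝ) ≤ s := by
    simp only [s, NNReal.coe_add, NNReal.coe_one]
    exact le_add_of_nonneg_left (NNReal.coe_nonneg _)
  have hfin : ENNReal.ofReal s ^ Q * ENNReal.ofReal Q ≠ ⊤ := by
    have := ENNReal.rpow_ne_top_of_nonneg hq.bound_nonneg (ENNReal.ofReal_ne_top (r := (s : ℝ)))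
    finiteness
  refine ⟨(ENNReal.ofReal s ^ Q * ENNReal.ofReal Q).toNNReal, fun u g hug hu hg => ?_⟩
  rw [ENNReal.coe_toNNReal hfin]
  obtain ⟨hext, k, hk, hbound⟩ := hT u g ((hcongr u g).1 hug)
  rw [← lpNorm_congr hΩ.measurableSet hqp, ← lpNorm_congr hΩ.measurableSet hqp] at hbound
  have ht1 : (1 : ℝ) ≤ t := by exact_mod_cast le_max_left 1 K
  have hKt : (K : ℝ≥0∞) ≤ ENNReal.ofReal t := by
    rw [ENNReal.ofReal_coe_nnreal]
    exact_mod_cast le_max_right 1 K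
  have hlt : lpNorm univ q (T u) + lpNorm univ q k < ENNReal.ofReal s := by
    refine hbound.trans_lt ?_
    have h1 := hq.lpNorm_le ht1 (hu.trans hKt)
    have h2 := hq.lpNorm_le ht1 (hg.trans hKt)
    rw [ENNReal.ofReal_coe_nnreal] at h1 h2 ⊢
    refine (mul_le_mul_right (add_le_add h1 h2) _).trans_lt ?_
    exact_mod_cast lt_add_one (A * (t + t))
  have hb1 := hq.lintegral_rpow_le_of_lpNorm_lt hs1 (le_self_add.trans_lt hlt)
  have hb2 := hq.lintegral_rpow_le_of_lpNorm_lt hs1 (le_add_self.trans_lt hlt)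
  have hm1 := hk.1.1.aemeasurable
  have hm2 := hk.2.1.1.aemeasurable
  have he2 : ∀ i, (fun x => k x i) =ᵐ[volume.restrict univ] fun x => hm2.mk k x i := fun i =>
    hm2.ae_eq_mk.mono fun x hx => by simp only [← hx]
  have hweak : ∀ i, HasWeakPartial univ (hm1.mk (T u)) i fun x => hm2.mk k x i := fun i =>
    (hk.2.2 i).congr_ae hm1.ae_eq_mk (he2 i)
  have hres : volume.restrict Ω ≤ (volume.restrict univ : Measure (Rn n)) :=
    Measure.restrict_mono (subset_univ _) le_rfl
  have hw : hm1.mk (T u) =ᵐ[volume.restrict Ω] u :=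
    (hm1.ae_eq_mk.symm.filter_mono (ae_mono hres)).trans hext
  refine ⟨hm1.mk _, hm2.mk _, hm1.measurable_mk, hm2.measurable_mk, hweak, hw, ?_, ?_, ?_⟩
  · have := ae_all_iff.2 fun i => (hweak i).ae_eq hΩ (hug.2.2 i) hw
    filter_upwards [this] with x hx
    ext i
    exact hx i
  · rw [← setLIntegral_univ]
    refine (lintegral_congr_ae ?_).trans_le hb1
    exact hm1.ae_eq_mk.symm.mono fun x hx => by simp only [hx]
  · rw [← setLIntegral_univ]
    refine (lintegral_congr_ae ?_).trans_le hb2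
    exact hm2.ae_eq_mk.symm.mono fun x hx => by simp only [hx]

/-! ### Compactness -/

/-- On bounded sets of `W^{1,q(·)}(Ω)`, smallness in `L¹` implies smallness of the modular. -/
lemma RegularExponent.exists_lintegral_rpow_le (hq : RegularExponent q Q C) (hΩ : IsOpen Ω)
    (hΩb : Bornology.IsBounded Ω) (hext : BoundedExtension Ω q) (K : ℝ≥0) {ε : ℝ≥0∞}
    (hε : ε ≠ 0) :
    ∃ η : ℝ≥0∞, 0 < η ∧ ∀ u g, IsSobolev Ω q u g → ∫⁻ x in Ω, ‖u x‖ₑ ^ q x ≤ K →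
      ∫⁻ x in Ω, ‖g x‖ₑ ^ q x ≤ K → ∫⁻ x in Ω, ‖u x‖ₑ ≤ η → ∫⁻ x in Ω, ‖u x‖ₑ ^ q x ≤ ε := by
  obtain ⟨K', hK'⟩ := hext K
  have hε2 : ε / 2 ≠ 0 := by simpa using hε
  obtain ⟨κ, hκ, h⟩ := hq.exists_equiintegrable hΩb K' hε2
  refine ⟨min κ (ε / 2), lt_min hκ (pos_iff_ne_zero.2 hε2), fun u g hug hu hg hη => ?_⟩
  obtain ⟨w, k, hw, hk, hwk, hwu, -, hwK, hkK⟩ := hK' u g hug hu hg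
  have e1 : ∫⁻ x in Ω, ‖u x‖ₑ ^ q x = ∫⁻ x in Ω, ‖w x‖ₑ ^ q x :=
    lintegral_congr_ae (hwu.mono fun x hx => by simp only [hx])
  have e2 : ∫⁻ x in Ω, ‖u x‖ₑ = ∫⁻ x in Ω, ‖w x‖ₑ :=
    lintegral_congr_ae (hwu.mono fun x hx => by simp only [hx])
  rw [e1]
  rw [e2] at hη
  -- Where |w| ≥ 1, Markov's inequality makes the set small and equi-integrability applies;
  -- elsewhere |w|^q ≤ |w|.
  set A : Set (Rn n) := {x | 1 ≤ ‖w x‖ₑ}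
  have hA : MeasurableSet A := measurableSet_le measurable_const hw.enorm
  have hmarkov : volume (Ω ∩ A) ≤ κ := by
    have := mul_meas_ge_le_lintegral (μ := volume.restrict Ω) hw.enorm 1
    rw [one_mul, Measure.restrict_apply hA, inter_comm] at this
    exact this.trans (hη.trans (min_le_left _ _))
  rw [← lintegral_inter_add_sdiff _ Ω hA, ← ENNReal.add_halves ε]
  refine add_le_add (h w k hw hk hwk hwK hkK _ inter_subset_left (hΩ.measurableSet.inter hA)
    hmarkov) ?_
  calc ∫⁻ x in Ω \ A, ‖w x‖ₑ ^ q x ≤ ∫⁻ x in Ω \ A, ‖w x‖ₑ :=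
        setLIntegral_mono' (hΩ.measurableSet.diff hA) fun x hx =>
          rpow_le_of_le_one (not_le.1 hx.2).le (hq.one_le x)
    _ ≤ ∫⁻ x in Ω, ‖w x‖ₑ := lintegral_mono_set sdiff_subset
    _ ≤ ε / 2 := hη.trans (min_le_right _ _)

/-- An inequality of Ehrling type: if the gradient is bounded in `L^{q(·)}(Ω)`, then smallness in
`L¹` implies smallness of the modular. -/
lemma RegularExponent.exists_lintegral_rpow_le_of_gradient (hq : RegularExponent q Q C)
    (hΩ : IsOpen Ω) (hΩb : Bornology.IsBounded Ω) (hext : BoundedExtension Ω q) (K : ℝ≥0)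
    {ε : ℝ≥0∞} (hε : ε ≠ 0) :
    ∃ η : ℝ≥0∞, 0 < η ∧ ∀ u g, IsSobolev Ω q u g → ∫⁻ x in Ω, ‖g x‖ₑ ^ q x ≤ K →
      ∫⁻ x in Ω, ‖u x‖ₑ ≤ η → ∫⁻ x in Ω, ‖u x‖ₑ ^ q x ≤ ε := by
  have hQ : (2 : ℝ≥0∞) ^ Q ≠ ⊤ := ENNReal.rpow_ne_top_of_nonneg hq.bound_nonneg (by simp)
  obtain ⟨ε', hε', hε'Q⟩ := exists_pos_mul_le hQ (ε := 1) one_ne_zero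
  obtain ⟨η, hη, h⟩ := hq.exists_lintegral_rpow_le hΩ hΩb hext (max K 1) (ε := min ε ε')
    (lt_min (pos_iff_ne_zero.2 hε) hε').ne'
  refine ⟨η, hη, fun u g hug hg huη => ?_⟩
  -- No bound on u itself is given, so u is halved until its modular is at most 1; halving preserves
  -- the bounds on the gradient and on the L¹ norm.
  set c : ℕ → ℝ := fun k => (2⁻¹ : ℝ) ^ k with hc
  have hce : ∀ k, ‖c k‖ₑ = (2⁻¹ : ℝ≥0∞) ^ k := fun k => by
    rw [hc, enorm_pow, ← ofReal_norm, Real.norm_of_nonneg (by norm_num),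
      ENNReal.ofReal_inv_of_pos two_pos, ENNReal.ofReal_ofNat]
  have hc1 : ∀ k, ‖c k‖ₑ ≤ 1 := fun k => by
    rw [hce]
    exact pow_le_one' (by simp) k
  set S : ℕ → ℝ≥0∞ := fun k => ∫⁻ x in Ω, ‖(c k • u) x‖ₑ ^ q x with hS
  have hsmul : ∀ {F : Type} [NormedAddCommGroup F] [NormedSpace ℝ F] (v : Rn n → F) (k : ℕ),
      ∫⁻ x in Ω, ‖(c k • v) x‖ₑ ^ q x ≤ ‖c k‖ₑ * ∫⁻ x in Ω, ‖v x‖ₑ ^ q x := by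
    intro F _ _ v k
    simp only [Pi.smul_apply, enorm_smul]
    exact hq.lintegral_mul_rpow_le_of_le_one (hc1 k) _
  have hlim : ∃ k, S k ≤ 1 := by
    have hfin : ∫⁻ x in Ω, ‖u x‖ₑ ^ q x ≠ ⊤ := (hq.memL_iff.1 hug.1).2.ne
    obtain ⟨ρ, hρ, hρ1⟩ := exists_pos_mul_le hfin (ε := 1) one_ne_zero
    have h2 : Tendsto (fun k : ℕ => (2⁻¹ : ℝ≥0∞) ^ k) atTop (𝓝 0) :=
      ENNReal.tendsto_pow_atTop_nhds_zero_of_lt_one (by simp)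
    obtain ⟨k, hk⟩ := (h2.eventually (gt_mem_nhds hρ)).exists
    refine ⟨k, (hsmul u k).trans ?_⟩
    rw [hce, mul_comm]
    exact (mul_le_mul_right hk.le _).trans hρ1
  classical
  have hmin : ∀ j, S j ≤ 1 → S j ≤ min ε ε' := by
    intro j hj
    refine h (c j • u) (c j • g) (hug.const_smul hq (hc1 j)) (hj.trans (by simp)) ?_ ?_
    · refine (hsmul g j).trans ((mul_le_of_le_one_left' (hc1 j)).trans (hg.trans ?_))
      exact_mod_cast le_max_left K 1
    · simp only [Pi.smul_apply, enorm_smul]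
      rw [lintegral_const_mul' _ _ enorm_ne_top]
      exact (mul_le_of_le_one_left' (hc1 j)).trans huη
  -- Take the least k with S k ≤ 1; then S k ≤ ε'. If k = j + 1, doubling gives S j ≤ 2^Q ε' ≤ 1,
  -- against minimality. So k = 0 and the bound by ε concerns u itself.
  have hk := hmin _ (Nat.find_spec hlim)
  rcases hfind : Nat.find hlim with _ | j
  · rw [hfind] at hk
    simpa [hS, hc] using hk.trans (min_le_left _ _)
  · exfalso
    refine Nat.find_min hlim (m := j) (by omega) ?_
    rw [hfind] at hk
    have hj : ∀ x, ‖(c j • u) x‖ₑ = 2 * ‖(c (j + 1) • u) x‖ₑ := fun x => by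
      simp only [Pi.smul_apply, enorm_smul, hce, pow_succ, ← mul_assoc]
      rw [mul_comm 2, mul_assoc _ (2 : ℝ≥0∞), ENNReal.mul_inv_cancel (by simp) (by simp),
        mul_one]
    calc S j = ∫⁻ x in Ω, (2 * ‖(c (j + 1) • u) x‖ₑ) ^ q x := by simp only [hS, hj]
      _ ≤ 2 ^ Q * S (j + 1) :=
          hq.lintegral_const_mul_rpow_le one_le_two (by simp) _
      _ ≤ 2 ^ Q * ε' := by
          gcongr
          exact hk.trans (min_le_right _ _)
      _ ≤ 1 := hε'Q

/-- A sequence in `W^{1,q(·)}(Ω)` with bounded gradients that converges in `L¹(Ω)` converges in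
`L^{q(·)}(Ω)`. -/
lemma RegularExponent.tendsto_lintegral_rpow_sub (hq : RegularExponent q Q C)
    (hΩ : IsOpen Ω) (hΩb : Bornology.IsBounded Ω) (hext : BoundedExtension Ω q) {K : ℝ≥0}
    {v : ℕ → Rn n → ℝ} {g : ℕ → Rn n → Rn n} {u : Rn n → ℝ}
    (hvg : ∀ h, IsSobolev Ω q (v h) (g h)) (hg : ∀ h, ∫⁻ x in Ω, ‖g h x‖ₑ ^ q x ≤ K)
    (hu : AEStronglyMeasurable u (volume.restrict Ω))
    (hvu : Tendsto (fun h => ∫⁻ x in Ω, ‖v h x - u x‖ₑ) atTop (𝓝 0)) :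
    Tendsto (fun h => ∫⁻ x in Ω, ‖v h x - u x‖ₑ ^ q x) atTop (𝓝 0) := by
  have hqm := hq.cont.measurable
  have hQ : (2 : ℝ≥0∞) ^ Q ≠ ⊤ := ENNReal.rpow_ne_top_of_nonneg hq.bound_nonneg (by simp)
  rw [ENNReal.tendsto_nhds_zero]
  intro ε hε
  obtain ⟨η, hη, h⟩ := hq.exists_lintegral_rpow_le_of_gradient hΩ hΩb hext
    (2 ^ Q * (K + K) : ℝ≥0∞).toNNReal hε.ne'
  rw [ENNReal.coe_toNNReal (by finiteness)] at h
  have hη2 : 0 < η / 2 := ENNReal.half_pos hη.ne'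
  obtain ⟨N, hN⟩ := eventually_atTop.1 (ENNReal.tendsto_nhds_zero.1 hvu _ hη2)
  -- The limit u is not known to be a Sobolev function, so the inequality is applied to differences
  -- of the sequence; Fatou's lemma along an almost everywhere convergent subsequence then replaces
  -- v b by u.
  have hcauchy : ∀ a ≥ N, ∀ b ≥ N, ∫⁻ x in Ω, ‖v a x - v b x‖ₑ ^ q x ≤ ε := by
    intro a ha b hb
    refine h (v a - v b) (g a - g b) ((hvg a).sub hq (hvg b)) ?_ ?_
    · refine (hq.lintegral_sub_rpow_le (hvg a).2.1.1).trans ?_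
      gcongr
      exacts [hg a, hg b]
    · calc ∫⁻ x in Ω, ‖(v a - v b) x‖ₑ
          ≤ ∫⁻ x in Ω, (‖v a x - u x‖ₑ + ‖v b x - u x‖ₑ) := by
            refine lintegral_mono fun x => ?_
            rw [Pi.sub_apply, ← sub_sub_sub_cancel_right _ _ (u x)]
            exact enorm_sub_le
        _ = (∫⁻ x in Ω, ‖v a x - u x‖ₑ) + ∫⁻ x in Ω, ‖v b x - u x‖ₑ :=
            lintegral_add_left' ((hvg a).1.1.sub hu).enorm _
        _ ≤ η / 2 + η / 2 := add_le_add (hN a ha) (hN b hb)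
        _ = η := ENNReal.add_halves η
  have hmeas : TendstoInMeasure (volume.restrict Ω) v atTop u := by
    refine tendstoInMeasure_of_tendsto_eLpNorm one_ne_zero (fun a => (hvg a).1.1) hu ?_
    simpa only [eLpNorm_one_eq_lintegral_enorm, Pi.sub_apply] using hvu
  obtain ⟨ns, hns, hae⟩ := hmeas.exists_seq_tendsto_ae
  filter_upwards [eventually_ge_atTop N] with a ha
  have hlim : ∀ᵐ x ∂volume.restrict Ω, ‖v a x - u x‖ₑ ^ q x =
      liminf (fun i => ‖v a x - v (ns i) x‖ₑ ^ q x) atTop := by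
    filter_upwards [hae] with x hx
    exact (((ENNReal.continuous_rpow_const.tendsto _).comp
      (tendsto_const_nhds.sub hx).enorm).liminf_eq).symm
  rw [lintegral_congr_ae hlim]
  refine (lintegral_liminf_le' fun i => ?_).trans ?_
  · exact ((hvg a).1.1.sub (hvg _).1.1).enorm.pow hqm.aemeasurable
  · refine liminf_le_of_frequently_le' (Eventually.frequently ?_)
    filter_upwards [eventually_ge_atTop N] with i hi
    exact hcauchy a ha _ (hi.trans (hns.id_le i))

end

/-! ### Vector-valued functions and comparison of the relaxed energies -/

section

/-! ### Components of vectors and matrices -/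

variable {n m : ℕ} {q : Rn n → ℝ} {Q C : ℝ} {Ω S : Set (Rn n)}

/-- The norm is at most the number of entries times the largest one, whose power is a term of the
sum. -/
lemma enorm_rpow_le_sum {ι : Type*} [Fintype ι] (ξ : EuclideanSpace ℝ ι) {s : ℝ} (hs : 1 ≤ s)
    (hsQ : s ≤ Q) :
    ‖ξ‖ₑ ^ s ≤ ((Fintype.card ι : ℝ≥0∞) + 1) ^ Q * ∑ i, ‖ξ i‖ₑ ^ s := by
  rcases isEmpty_or_nonempty ι with hι | hι
  · simp [Subsingleton.elim ξ 0, ENNReal.zero_rpow_of_pos (zero_lt_one.trans_le hs)]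
  · obtain ⟨j, hj⟩ := Finite.exists_max fun i => ‖ξ i‖
    have hN : (1 : ℝ) ≤ Fintype.card ι := by exact_mod_cast Fintype.card_pos
    have h1 : ‖ξ‖ ≤ Fintype.card ι * ‖ξ j‖ := by
      rw [EuclideanSpace.norm_eq]
      refine Real.sqrt_le_iff.2 ⟨by positivity, ?_⟩
      calc ∑ i, ‖ξ i‖ ^ 2 ≤ ∑ _i : ι, ‖ξ j‖ ^ 2 := by
            gcongr with i
            exact hj i
        _ = Fintype.card ι * ‖ξ j‖ ^ 2 := by simp
        _ ≤ _ := by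
            rw [mul_pow]
            gcongr
            exact le_self_pow₀ hN two_ne_zero
    have h2 : ‖ξ‖ₑ ≤ (Fintype.card ι + 1) * ‖ξ j‖ₑ := by
      have h3 := ENNReal.ofReal_le_ofReal h1
      rw [ENNReal.ofReal_mul (by positivity), ENNReal.ofReal_natCast, ofReal_norm,
        ofReal_norm] at h3
      exact h3.trans (by gcongr; exact le_self_add)
    calc ‖ξ‖ₑ ^ s ≤ ((Fintype.card ι + 1) * ‖ξ j‖ₑ) ^ s :=
          ENNReal.rpow_le_rpow h2 (by linarith)
      _ = (Fintype.card ι + 1) ^ s * ‖ξ j‖ₑ ^ s := ENNReal.mul_rpow_of_nonneg _ _ (by linarith)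
      _ ≤ _ := by
          gcongr
          · exact le_add_self
          · exact Finset.single_le_sum (f := fun i => ‖ξ i‖ₑ ^ s) (fun _ _ => zero_le)
              (Finset.mem_univ j)

lemma RegularExponent.lintegral_rpow_le_sum {ι : Type*} [Fintype ι]
    (hq : RegularExponent q Q C) {w : Rn n → EuclideanSpace ℝ ι}
    (hw : AEStronglyMeasurable w (volume.restrict S)) :
    ∫⁻ x in S, ‖w x‖ₑ ^ q x ≤
      ((Fintype.card ι : ℝ≥0∞) + 1) ^ Q * ∑ i, ∫⁻ x in S, ‖w x i‖ₑ ^ q x := by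
  have hqm := hq.cont.measurable
  have hfin : ((Fintype.card ι : ℝ≥0∞) + 1) ^ Q ≠ ⊤ :=
    ENNReal.rpow_ne_top_of_nonneg hq.bound_nonneg (by finiteness)
  rw [← lintegral_finsetSum' _ fun i _ => ?_, ← lintegral_const_mul' _ _ hfin]
  · exact lintegral_mono fun x => enorm_rpow_le_sum _ (hq.one_le x) (hq.le_bound x)
  · have : AEStronglyMeasurable (fun x => w x i) (volume.restrict S) :=
      (EuclideanSpace.proj (𝕜 := ℝ) i : EuclideanSpace ℝ ι →L[ℝ] ℝ).continuous.comp_aestronglyMeasurable hw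
    exact this.enorm.pow hqm.aemeasurable

/-- The rows of a matrix. -/
def matRow (α : Fin m) (ξ : Mat m n) : Rn n := WithLp.toLp 2 fun i => ξ (α, i)

lemma continuous_matRow (α : Fin m) : Continuous (matRow (n := n) α) := by
  unfold matRow
  fun_prop

lemma enorm_matRow_le (α : Fin m) (ξ : Mat m n) : ‖matRow α ξ‖ₑ ≤ ‖ξ‖ₑ := by
  rw [← ofReal_norm, ← ofReal_norm]
  refine ENNReal.ofReal_le_ofReal ?_
  rw [EuclideanSpace.norm_eq, EuclideanSpace.norm_eq]
  refine Real.sqrt_le_sqrt ?_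
  rw [Fintype.sum_prod_type]
  exact Finset.single_le_sum (f := fun β => ∑ i, ‖ξ (β, i)‖ ^ 2) (fun _ _ => by positivity)
    (Finset.mem_univ α)

lemma IsSobolevVec.isSobolev (hq : RegularExponent q Q C) {u : Rn n → Rn m} {G : Rn n → Mat m n}
    (h : IsSobolevVec Ω q u G) (α : Fin m) :
    IsSobolev Ω q (fun x => u x α) fun x => matRow α (G x) := by
  obtain ⟨hu, hG⟩ := hq.memL_iff.1 h.1
  obtain ⟨hg, hgG⟩ := hq.memL_iff.1 h.2.1
  refine ⟨hq.memL_iff.2 ⟨(EuclideanSpace.proj (𝕜 := ℝ) α :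
    Rn m →L[ℝ] ℝ).continuous.comp_aestronglyMeasurable hu, lt_of_le_of_lt ?_ hG⟩,
    hq.memL_iff.2 ⟨(continuous_matRow α).comp_aestronglyMeasurable hg, lt_of_le_of_lt ?_ hgG⟩,
    fun i => h.2.2 α i⟩
  · exact lintegral_mono fun x => ENNReal.rpow_le_rpow (PiLp.enorm_apply_le _ _) (hq.pos x).le
  · exact lintegral_mono fun x => ENNReal.rpow_le_rpow (enorm_matRow_le _ _) (hq.pos x).le

/-! ### Smooth functions -/

lemma classicalGrad_apply {v : Rn n → Rn m} {x : Rn n} (hv : DifferentiableAt ℝ v x) (α : Fin m)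
    (i : Fin n) : classicalGrad v x (α, i) =
      fderiv ℝ (fun y => v y α) x (EuclideanSpace.single i 1) := by
  have h := (EuclideanSpace.proj (𝕜 := ℝ) α : Rn m →L[ℝ] ℝ).hasFDerivAt.comp x hv.hasFDerivAt
  have h' : fderiv ℝ (fun y => v y α) x = _ := h.fderiv
  rw [h']
  rfl

lemma continuous_classicalGrad {v : Rn n → Rn m} (hv : ContDiff ℝ ∞ v) :
    Continuous (classicalGrad v) := by
  have h : Continuous (fderiv ℝ v) := hv.continuous_fderiv (by simp)
  unfold classicalGrad
  fun_prop

lemma RegularExponent.memL_of_continuous {E : Type*} [NormedAddCommGroup E]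
    [SecondCountableTopology E] (hq : RegularExponent q Q C) (hΩ : MeasurableSet Ω)
    (hΩb : Bornology.IsBounded Ω) {w : Rn n → E} (hw : Continuous w) : MemL Ω q w := by
  refine hq.memL_iff.2 ⟨hw.aestronglyMeasurable, ?_⟩
  obtain ⟨M, hM⟩ := (hΩb.isCompact_closure).exists_bound_of_continuousOn hw.continuousOn
  have hle : ∀ x ∈ Ω, ‖w x‖ₑ ^ q x ≤ (max 1 (ENNReal.ofReal M)) ^ Q := by
    intro x hx
    calc ‖w x‖ₑ ^ q x ≤ (max 1 (ENNReal.ofReal M)) ^ q x := by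
          refine ENNReal.rpow_le_rpow (le_max_of_le_right ?_) (hq.pos x).le
          rw [← ofReal_norm]
          exact ENNReal.ofReal_le_ofReal (hM x (subset_closure hx))
      _ ≤ _ := ENNReal.rpow_le_rpow_of_exponent_le (le_max_left _ _) (hq.le_bound x)
  refine (setLIntegral_mono' hΩ hle).trans_lt ?_
  rw [setLIntegral_const]
  exact ENNReal.mul_lt_top (ENNReal.rpow_lt_top_of_nonneg hq.bound_nonneg (by simp))
    hΩb.measure_lt_top

lemma hasWeakPartial_of_contDiff {v : Rn n → ℝ} (hv : ContDiff ℝ ∞ v) (i : Fin n) :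
    HasWeakPartial Ω v i fun x => fderiv ℝ v x (EuclideanSpace.single i 1) := by
  have hd : ∀ {η : Rn n → ℝ}, ContDiff ℝ ∞ η →
      Continuous fun x => fderiv ℝ η x (EuclideanSpace.single i 1) := fun hη =>
    (hη.continuous_fderiv (by simp)).clm_apply continuous_const
  refine ⟨hv.continuous.locallyIntegrable.locallyIntegrableOn _,
    (hd hv).locallyIntegrable.locallyIntegrableOn _, fun η hη hc hs => ?_⟩
  have hds := tsupport_fderiv_apply_subset_tsupport (η := η) (EuclideanSpace.single i 1)
  have hdc : HasCompactSupport fun x => fderiv ℝ η x (EuclideanSpace.single i 1) :=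
    hc.mono' ((subset_tsupport _).trans hds)
  have hint : ∀ {f g : Rn n → ℝ}, Continuous f → Continuous g → HasCompactSupport g →
      Integrable fun x => f x * g x := fun hf hg hgc =>
    (hf.mul hg).integrable_of_hasCompactSupport hgc.mul_left
  rw [setIntegral_eq_integral_of_forall_compl_eq_zero, setIntegral_eq_integral_of_forall_compl_eq_zero]
  · exact integral_mul_fderiv_eq_neg_fderiv_mul_of_integrable
      (hint (hd hv) hη.continuous hc) (hint hv.continuous (hd hη) hdc)
      (hint hv.continuous hη.continuous hc) (fun x _ => hv.differentiable (by simp) x)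
      (fun x _ => hη.differentiable (by simp) x)
  · intro x hx
    rw [image_eq_zero_of_notMem_tsupport (fun h => hx (hs h)), mul_zero]
  · intro x hx
    rw [image_eq_zero_of_notMem_tsupport
      (f := fun x => fderiv ℝ η x (EuclideanSpace.single i 1)) (fun h => hx (hs (hds h))), mul_zero]

lemma isSobolevVec_of_contDiff (hq : RegularExponent q Q C) (hΩ : MeasurableSet Ω)
    (hΩb : Bornology.IsBounded Ω) {v : Rn n → Rn m} (hv : ContDiff ℝ ∞ v) :
    IsSobolevVec Ω q v (classicalGrad v) := by
  refine ⟨hq.memL_of_continuous hΩ hΩb hv.continuous,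
    hq.memL_of_continuous hΩ hΩb (continuous_classicalGrad hv), fun α i => ?_⟩
  have hvα : ContDiff ℝ ∞ fun y => v y α :=
    (EuclideanSpace.proj (𝕜 := ℝ) α : Rn m →L[ℝ] ℝ).contDiff.comp hv
  simp only [fun x => classicalGrad_apply (hv.differentiable (by simp) x) α i]
  exact hasWeakPartial_of_contDiff hvα i

lemma classicalGrad_mollify (j : ℕ) {w : Rn n → Rn m} {k : Rn n → Mat m n}
    (hw : LocallyIntegrable w) (hk : LocallyIntegrable k)
    (h : ∀ α i, HasWeakPartial univ (fun x => w x α) i fun x => k x (α, i)) :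
    classicalGrad (mollify j w) = mollify j k := by
  funext x
  ext ⟨α, i⟩
  rw [classicalGrad_apply ((contDiff_mollify j hw).differentiable (by simp) x),
    mollify_apply j hk, ← fderiv_mollify_of_hasWeakPartial j (h α i)]
  simp only [fun y => mollify_apply j hw y α]

/-! ### The two inequalities -/

section Energy

variable {f : Mat m n → ℝ}

/-- Each component is extended to ℝⁿ and the extension is mollified. L¹ closeness and convergence of
the energy are two instances of `RegularExponent.tendsto_setLIntegral_comp_mollify`. -/
lemma exists_contDiff_approx (hq : RegularExponent q Q C) (hΩ : IsOpen Ω)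
    (hΩb : Bornology.IsBounded Ω) (hext : BoundedExtension Ω q) (hf : Continuous f)
    (hf0 : ∀ ξ, 0 ≤ f ξ) {M : ℝ} (hM : 1 ≤ M) (hfM : ∀ ξ, f ξ ≤ M * (1 + ‖ξ‖))
    {v : Rn n → Rn m} {G : Rn n → Mat m n} (hv : IsSobolevVec Ω q v G) {ε : ℝ≥0∞} (hε : ε ≠ 0) :
    ∃ W : Rn n → Rn m, ContDiff ℝ ∞ W ∧ ∫⁻ x in Ω, ‖W x - v x‖ₑ ≤ ε ∧
      energy Ω q f (classicalGrad W) ≤ energy Ω q f G + ε := by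
  have hqm := hq.cont.measurable
  have hΩfin : volume Ω ≠ ⊤ := hΩb.measure_lt_top.ne
  have hcard : ∀ N : ℕ, ((N : ℝ≥0∞) + 1) ^ Q ≠ ⊤ := fun N =>
    ENNReal.rpow_ne_top_of_nonneg hq.bound_nonneg (by finiteness)
  have hrow := fun α => hv.isSobolev hq α
  have hfinite : ∀ α, ∃ K : ℝ≥0, ∫⁻ x in Ω, ‖v x α‖ₑ ^ q x ≤ K ∧
      ∫⁻ x in Ω, ‖matRow α (G x)‖ₑ ^ q x ≤ K := by
    intro α
    have h1 := (hq.memL_iff.1 (hrow α).1).2.ne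
    have h2 := (hq.memL_iff.1 (hrow α).2.1).2.ne
    refine ⟨(max (∫⁻ x in Ω, ‖v x α‖ₑ ^ q x) (∫⁻ x in Ω, ‖matRow α (G x)‖ₑ ^ q x)).toNNReal, ?_⟩
    rw [ENNReal.coe_toNNReal (max_lt h1.lt_top h2.lt_top).ne]
    exact ⟨le_max_left _ _, le_max_right _ _⟩
  choose K hKv hKG using hfinite
  choose K' hK' using fun α => hext (K α)
  choose w k hwm hkm hwk hwv hkG hwK hkK using fun α => hK' α _ _ (hrow α) (hKv α) (hKG α)
  set w' : Rn n → Rn m := fun x => WithLp.toLp 2 fun α => w α x with hw'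
  set k' : Rn n → Mat m n := fun x => WithLp.toLp 2 fun β : Fin m × Fin n => k β.1 x β.2 with hk'
  have hw'm : Measurable w' := by
    refine (WithLp.measurable_toLp 2 (Fin m → ℝ)).comp (measurable_pi_lambda _ fun α => hwm α)
  have hk'm : Measurable k' := by
    refine (WithLp.measurable_toLp 2 (Fin m × Fin n → ℝ)).comp
      (measurable_pi_lambda _ fun β => ?_)
    have := hkm β.1
    fun_prop
  have hw'fin : ∫⁻ x, ‖w' x‖ₑ ^ q x ≠ ⊤ := by
    have h1 := hq.lintegral_rpow_le_sum (S := univ) hw'm.aestronglyMeasurable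
    rw [setLIntegral_univ] at h1
    refine ne_top_of_le_ne_top (ENNReal.mul_ne_top (hcard _) (ENNReal.sum_ne_top.2 fun α _ => ?_)) h1
    rw [setLIntegral_univ]
    exact ne_top_of_le_ne_top ENNReal.coe_ne_top (hwK α)
  have hk'fin : ∫⁻ x, ‖k' x‖ₑ ^ q x ≠ ⊤ := by
    have h1 := hq.lintegral_rpow_le_sum (S := univ) hk'm.aestronglyMeasurable
    rw [setLIntegral_univ] at h1
    refine ne_top_of_le_ne_top (ENNReal.mul_ne_top (hcard _) (ENNReal.sum_ne_top.2 fun β _ => ?_)) h1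
    rw [setLIntegral_univ]
    refine ne_top_of_le_ne_top ENNReal.coe_ne_top (le_trans ?_ (hkK β.1))
    exact lintegral_mono fun x => ENNReal.rpow_le_rpow (PiLp.enorm_apply_le _ _) (hq.pos x).le
  have hw'l := hq.locallyIntegrable hw'm hw'fin
  have hk'l := hq.locallyIntegrable hk'm hk'fin
  have hae_w : w' =ᵐ[volume.restrict Ω] v := by
    filter_upwards [ae_all_iff.2 hwv] with x hx
    ext α
    exact hx α
  have hae_k : k' =ᵐ[volume.restrict Ω] G := by
    filter_upwards [ae_all_iff.2 hkG] with x hx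
    ext β
    have := congrArg (fun ξ : Rn n => ξ β.2) (hx β.1)
    simpa [matRow, hk'] using this
  have hmw : ∀ j, Measurable (mollify j w') := fun j =>
    (contDiff_mollify j hw'l).continuous.measurable
  have hmk : ∀ j, Measurable (mollify j k') := fun j =>
    (contDiff_mollify j hk'l).continuous.measurable
  have hlim1 := hq.tendsto_setLIntegral_comp_mollify hΩ.measurableSet hΩfin hw'm hw'l hw'fin
    (H := fun x ξ => ‖ξ - w' x‖ₑ) (fun x _ => by fun_prop)
    (fun j => ((hmw j).sub hw'm).enorm.aemeasurable) 2 (by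
      intro x _ ξ
      have h1 := le_one_add_rpow (a := ‖ξ‖ₑ) (hq.one_le x)
      have h2 := le_one_add_rpow (a := ‖w' x‖ₑ) (hq.one_le x)
      have h3 : ‖ξ - w' x‖ₑ ≤ ‖ξ‖ₑ + ‖w' x‖ₑ := enorm_sub_le
      refine h3.trans ((add_le_add h1 h2).trans ?_)
      calc 1 + ‖ξ‖ₑ ^ q x + (1 + ‖w' x‖ₑ ^ q x)
          ≤ 1 + ‖ξ‖ₑ ^ q x + (1 + ‖w' x‖ₑ ^ q x) + (‖ξ‖ₑ ^ q x + ‖w' x‖ₑ ^ q x) := le_self_add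
        _ = _ := by push_cast; ring)
  simp only [sub_self, enorm_zero, lintegral_zero] at hlim1
  have hcM : (2 * ENNReal.ofReal M) ^ Q ≠ ⊤ :=
    ENNReal.rpow_ne_top_of_nonneg hq.bound_nonneg (by finiteness)
  have hM1 : 1 ≤ ENNReal.ofReal M := by simpa using hM
  have hlim2 := hq.tendsto_setLIntegral_comp_mollify hΩ.measurableSet hΩfin hk'm hk'l hk'fin
    (H := fun x ξ => ENNReal.ofReal (f ξ ^ q x))
    (fun x _ => ENNReal.continuous_ofReal.comp (hf.rpow_const fun _ => Or.inr (hq.pos x).le))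
    (fun j => ((hf.measurable.comp (hmk j)).pow hqm).ennreal_ofReal.aemeasurable)
    ((2 * ENNReal.ofReal M) ^ Q).toNNReal (by
      intro x _ ξ
      rw [ENNReal.coe_toNNReal hcM, ← ENNReal.ofReal_rpow_of_nonneg (hf0 ξ) (hq.pos x).le]
      have h1 : ENNReal.ofReal (f ξ) ≤ ENNReal.ofReal M * (1 + ‖ξ‖ₑ) := by
        refine (ENNReal.ofReal_le_ofReal (hfM ξ)).trans_eq ?_
        rw [ENNReal.ofReal_mul (by linarith), ENNReal.ofReal_add zero_le_one (norm_nonneg _),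
          ENNReal.ofReal_one, ofReal_norm]
      -- The growth bound is first put in the form 2M max(1, |ξ|), so that the power acts on a
      -- product.
      calc ENNReal.ofReal (f ξ) ^ q x
          ≤ (2 * ENNReal.ofReal M * max 1 ‖ξ‖ₑ) ^ q x := by
            refine ENNReal.rpow_le_rpow (h1.trans ?_) (hq.pos x).le
            rw [mul_comm 2, mul_assoc, two_mul]
            gcongr
            · exact le_max_left _ _
            · exact le_max_right _ _
        _ ≤ (2 * ENNReal.ofReal M) ^ Q * (max 1 ‖ξ‖ₑ) ^ q x := by
            rw [ENNReal.mul_rpow_of_nonneg _ _ (hq.pos x).le]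
            gcongr
            · exact one_le_two.trans (le_mul_of_one_le_right' hM1)
            · exact hq.le_bound x
        _ ≤ _ := by
            gcongr
            rcases max_cases (1 : ℝ≥0∞) ‖ξ‖ₑ with ⟨h2, -⟩ | ⟨h2, -⟩
            · rw [h2, ENNReal.one_rpow, add_assoc]
              exact le_self_add
            · rw [h2]
              exact le_add_self.trans le_self_add)
  have hE : ∫⁻ x in Ω, ENNReal.ofReal (f (k' x) ^ q x) = energy Ω q f G :=
    lintegral_congr_ae (hae_k.mono fun x hx => by simp only [hx])
  rw [hE] at hlim2
  have hev : ∀ᶠ j in atTop, ∫⁻ x in Ω, ENNReal.ofReal (f (mollify j k' x) ^ q x) ≤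
      energy Ω q f G + ε := by
    rcases eq_or_ne (energy Ω q f G) ⊤ with htop | htop
    · simp [htop]
    · exact (hlim2.eventually (gt_mem_nhds (ENNReal.lt_add_right htop hε))).mono fun j hj => hj.le
  obtain ⟨j, hj1, hj2⟩ := ((ENNReal.tendsto_nhds_zero.1 hlim1 ε (pos_iff_ne_zero.2 hε)).and
    hev).exists
  refine ⟨mollify j w', contDiff_mollify j hw'l, ?_, ?_⟩
  · refine le_of_eq_of_le (lintegral_congr_ae ?_) hj1
    exact hae_w.mono fun x hx => by simp only [← hx]
  · rw [classicalGrad_mollify j hw'l hk'l fun α i => hwk α i]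
    exact hj2

lemma relaxedSmooth_le_relaxed (hq : RegularExponent q Q C) (hΩ : IsOpen Ω)
    (hΩb : Bornology.IsBounded Ω) (hext : BoundedExtension Ω q) (hf : Continuous f)
    (hf0 : ∀ ξ, 0 ≤ f ξ) {M : ℝ} (hM : 1 ≤ M) (hfM : ∀ ξ, f ξ ≤ M * (1 + ‖ξ‖))
    {u : Rn n → Rn m} (hu : AEStronglyMeasurable u (volume.restrict Ω)) :
    relaxedSmooth Ω q f u ≤ relaxed Ω q f u := by
  have hΩfin : volume Ω ≠ ⊤ := hΩb.measure_lt_top.ne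
  refine le_sInf ?_
  rintro _ ⟨v, G, hv, hvu, rfl⟩
  obtain ⟨θ, hθE, hθ⟩ := exists_seq_tendsto_liminf (f := atTop)
    (u := fun h => energy Ω q f (G h))
  -- At h = 0 the tolerance is `0⁻¹ = ⊤`, which is harmless.
  have hε : ∀ h : ℕ, ((h : ℝ≥0∞))⁻¹ ≠ 0 := fun h => by simp
  choose W hWs hWv hWE using fun h : ℕ =>
    exists_contDiff_approx hq hΩ hΩb hext hf hf0 hM hfM (hv (θ h)) (hε h)
  have hinv : Tendsto (fun h : ℕ => ((h : ℝ≥0∞))⁻¹) atTop (𝓝 0) :=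
    ENNReal.tendsto_inv_nat_nhds_zero
  have hlim : Tendsto (fun h => energy Ω q f (G (θ h)) + ((h : ℝ≥0∞))⁻¹) atTop
      (𝓝 (liminf (fun h => energy Ω q f (G h)) atTop)) := by
    simpa using hθE.add hinv
  refine le_trans (b := liminf (fun h => energy Ω q f (classicalGrad (W h))) atTop)
    (sInf_le ⟨W, hWs, ?_, rfl⟩)
    ((liminf_le_liminf (Eventually.of_forall hWE)).trans_eq hlim.liminf_eq)
  have hb : Tendsto (fun h : ℕ => ((h : ℝ≥0∞))⁻¹ +
      lpNorm Ω q (v (θ h) - u) * (volume Ω + ENNReal.ofReal Q)) atTop (𝓝 0) := by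
    simpa using hinv.add (ENNReal.Tendsto.mul_const (hvu.comp hθ)
      (Or.inr (by finiteness : volume Ω + ENNReal.ofReal Q ≠ ⊤)))
  refine tendsto_of_tendsto_of_tendsto_of_le_of_le tendsto_const_nhds hb
    (fun _ => zero_le) fun h => ?_
  calc ∫⁻ x in Ω, ‖W h x - u x‖ₑ
      ≤ ∫⁻ x in Ω, (‖W h x - v (θ h) x‖ₑ + ‖v (θ h) x - u x‖ₑ) := by
        refine lintegral_mono fun x => ?_
        rw [← sub_add_sub_cancel (W h x) (v (θ h) x) (u x)]
        exact enorm_add_le _ _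
    _ = (∫⁻ x in Ω, ‖W h x - v (θ h) x‖ₑ) + ∫⁻ x in Ω, ‖(v (θ h) - u) x‖ₑ :=
        lintegral_add_right' _ ((hv (θ h)).1.1.sub hu).enorm
    _ ≤ _ := add_le_add (hWv h) (hq.lintegral_le_lpNorm_mul _ hΩfin)

lemma relaxed_le_relaxedSmooth (hq : RegularExponent q Q C) (hΩ : IsOpen Ω)
    (hΩb : Bornology.IsBounded Ω) (hext : BoundedExtension Ω q)
    (hf0 : ∀ ξ, 0 ≤ f ξ) {c : ℝ} (hc : 0 < c) (hcf : ∀ ξ, c * ‖ξ‖ ≤ f ξ)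
    {u : Rn n → Rn m} (hu : AEStronglyMeasurable u (volume.restrict Ω)) :
    relaxed Ω q f u ≤ relaxedSmooth Ω q f u := by
  refine le_sInf ?_
  rintro _ ⟨v, hv, hvu, rfl⟩
  set L := liminf (fun h => energy Ω q f (classicalGrad (v h))) atTop with hL
  rcases eq_or_ne L ⊤ with htop | htop
  · rw [htop]
    exact le_top
  obtain ⟨θ, hθE, hθ⟩ := exists_seq_tendsto_liminf (f := atTop)
    (u := fun h => energy Ω q f (classicalGrad (v h)))
  -- Dropping finitely many terms of a subsequence realizing the liminf bounds all the energies by L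
  -- + 1, and with them the gradients.
  obtain ⟨N, hN⟩ := eventually_atTop.1
    (hθE.eventually (gt_mem_nhds (ENNReal.lt_add_right htop one_ne_zero)))
  set σ : ℕ → ℕ := fun h => θ (h + N) with hσ
  have hσt : Tendsto σ atTop atTop := hθ.comp (tendsto_add_atTop_nat N)
  have hσE : Tendsto (fun h => energy Ω q f (classicalGrad (v (σ h)))) atTop (𝓝 L) :=
    hθE.comp (tendsto_add_atTop_nat N)
  have hEle : ∀ h, energy Ω q f (classicalGrad (v (σ h))) ≤ L + 1 := fun h =>
    (hN (h + N) (Nat.le_add_left _ _)).le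
  set A : ℝ≥0∞ := max 1 (ENNReal.ofReal c⁻¹)
  have hAtop : A ^ Q ≠ ⊤ := ENNReal.rpow_ne_top_of_nonneg hq.bound_nonneg (by simp [A])
  have hgrad : ∀ h, ∫⁻ x in Ω, ‖classicalGrad (v (σ h)) x‖ₑ ^ q x ≤ A ^ Q * (L + 1) := by
    intro h
    have hpt : ∀ ξ, ‖ξ‖ₑ ≤ A * ENNReal.ofReal (f ξ) := by
      intro ξ
      have h1 : ‖ξ‖ ≤ c⁻¹ * f ξ := by
        rw [inv_mul_eq_div, le_div_iff₀ hc, mul_comm]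
        exact hcf ξ
      have h2 := ENNReal.ofReal_le_ofReal h1
      rw [ofReal_norm, ENNReal.ofReal_mul (by positivity)] at h2
      exact h2.trans (by gcongr; exact le_max_right _ _)
    calc ∫⁻ x in Ω, ‖classicalGrad (v (σ h)) x‖ₑ ^ q x
        ≤ ∫⁻ x in Ω, (A * ENNReal.ofReal (f (classicalGrad (v (σ h)) x))) ^ q x :=
          lintegral_mono fun x => ENNReal.rpow_le_rpow (hpt _) (hq.pos x).le
      _ ≤ A ^ Q * ∫⁻ x in Ω, ENNReal.ofReal (f (classicalGrad (v (σ h)) x)) ^ q x :=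
          hq.lintegral_const_mul_rpow_le (le_max_left _ _) (by simp) _
      _ = A ^ Q * energy Ω q f (classicalGrad (v (σ h))) := by
          congr 1
          exact lintegral_congr fun x => ENNReal.ofReal_rpow_of_nonneg (hf0 _) (hq.pos x).le
      _ ≤ _ := by
          gcongr
          exact hEle h
  have hsob : ∀ h, IsSobolevVec Ω q (v (σ h)) (classicalGrad (v (σ h))) := fun h =>
    isSobolevVec_of_contDiff hq hΩ.measurableSet hΩb (hv _)
  have hcomp : ∀ α, Tendsto (fun h => ∫⁻ x in Ω, ‖v (σ h) x α - u x α‖ₑ ^ q x) atTop (𝓝 0) := by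
    intro α
    refine hq.tendsto_lintegral_rpow_sub hΩ hΩb hext (K := (A ^ Q * (L + 1)).toNNReal)
      (fun h => (hsob h).isSobolev hq α) (fun h => ?_)
      ((EuclideanSpace.proj (𝕜 := ℝ) α : Rn m →L[ℝ] ℝ).continuous.comp_aestronglyMeasurable hu) ?_
    · rw [ENNReal.coe_toNNReal (ENNReal.mul_ne_top hAtop (by finiteness))]
      refine le_trans (lintegral_mono fun x => ?_) (hgrad h)
      exact ENNReal.rpow_le_rpow (enorm_matRow_le _ _) (hq.pos x).le
    · refine tendsto_of_tendsto_of_tendsto_of_le_of_le tendsto_const_nhds (hvu.comp hσt)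
        (fun _ => zero_le) fun h => ?_
      exact lintegral_mono fun x => PiLp.enorm_apply_le (v (σ h) x - u x) α
  refine sInf_le ⟨fun h => v (σ h), fun h => classicalGrad (v (σ h)), hsob, ?_,
    hσE.liminf_eq.symm⟩
  refine hq.tendsto_lpNorm ?_
  have hcard : ((Fintype.card (Fin m) : ℝ≥0∞) + 1) ^ Q ≠ ⊤ :=
    ENNReal.rpow_ne_top_of_nonneg hq.bound_nonneg (by finiteness)
  have hsum := ENNReal.Tendsto.const_mul (tendsto_finsetSum Finset.univ fun α _ => hcomp α)
    (Or.inr hcard)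
  rw [Finset.sum_const_zero, mul_zero] at hsum
  exact tendsto_of_tendsto_of_tendsto_of_le_of_le tendsto_const_nhds hsum
    (fun _ => zero_le) fun h =>
      hq.lintegral_rpow_le_sum ((hsob h).1.1.sub hu)

end Energy

end

end VarExp

end

theorem proposition4p6 {n m : ℕ} (hn : 2 ≤ n)
    (Ω : Set (VarExp.Rn n)) (hΩo : IsOpen Ω) (hΩb : Bornology.IsBounded Ω)
    (p : VarExp.Rn n → ℝ) (hp1 : ∀ x ∈ Ω, 1 ≤ p x) (hp : VarExp.LogHolder Ω p)
    (hΩ : VarExp.IsExtensionDomain Ω p)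
    (f : VarExp.Mat m n → ℝ) (hf_nonneg : ∀ ξ, 0 ≤ f ξ)
    (hf0 : Continuous f ∧ f 0 = 0)
    (hf2 : ∃ c : ℝ, 0 < c ∧ ∀ ξ, c * ‖ξ‖ ≤ f ξ)
    (hf3 : ∃ M : ℝ, 1 ≤ M ∧ ∀ ξ, f ξ ≤ M * (1 + ‖ξ‖))
    (u : VarExp.Rn n → VarExp.Rn m) (hu : VarExp.MemBV Ω p u) :
    VarExp.relaxed Ω p f u = VarExp.relaxedSmooth Ω p f u := by
  obtain ⟨q, Q, C, hq, hqp, hext⟩ := hΩ.exists_boundedExtension hΩo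
  obtain ⟨c, hc, hcf⟩ := hf2
  obtain ⟨M, hM, hfM⟩ := hf3
  -- Both functionals see the exponent only on Ω, where q = p.
  rw [← VarExp.relaxed_congr hΩo.measurableSet hqp,
    ← VarExp.relaxedSmooth_congr hΩo.measurableSet hqp]
  exact le_antisymm
    (VarExp.relaxed_le_relaxedSmooth hq hΩo hΩb hext hf_nonneg hc hcf hu.1.1)
    (VarExp.relaxedSmooth_le_relaxed hq hΩo hΩb hext hf0.1 hf_nonneg hM hfM hu.1.1)
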